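/- **Setting.** Let $J,T\in\mathbb N$ and $0<a_t\le b_t$ for $t=1,\dots,T$. Let $\Omega$ be a non-empty closed subset of $\prod_{t=1}^T\big([a_t,b_t]\times\mathbb R_+^J\big)$ with its Euclidean topology and Borel $\sigma$-algebra. Put $S^0_0=1$, let $S^j_0\in\mathbb R_+$ ($j=1,\dots,J$) be given numbers, and put $S^j_t(\omega)=\omega^j_t$ for $t=1,\dots,T$, $j=0,\dots,J$. Let $\mathcal F_t=\sigma(S^j_s: j=0,\dots,J,\ s\le t)$, $\tilde S^j_t=S^j_t/S^0_t$ and $\Delta\tilde S^j_t=\tilde S^j_t-\tilde S^j_{t-1}$. Fix $p\ge 1$ and let $Z=1+\sum_{j=1}^J\sum_{t=1}^T(\tilde S^j_t)^p$. Let $B$ be the set of Borel functions $X:\Omega\to\mathbb R$, $B^+=\{X\in B: X\ge 0\}$, $B_Z=\{X\in B: X/Z\text{ bounded}\}$, and let $U_Z$ and $C_Z$ be the sets of upper semicontinuous and of continuous elements of $B_Z$, respectively. Let $\mathcal P_Z$ be the set of Borel probability measures $\mathbb P$ on $\Omega$ with $\mathbb E^{\mathbb P}Z<\infty$. For $X\in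 B$ put $\mathbb E^{\mathbb P}X:=\mathbb E^{\mathbb P}X^+-\mathbb E^{\mathbb P}X^-$ if $\mathbb E^{\mathbb P}X^-<\infty$ and $\mathbb E^{\mathbb P}X:=-\infty$ otherwise. Let $I$ be any index set, $H_i\in C_Z$ for $i\in I$, let $\Theta$ be a convex set, containing $0$, of vectors in $\mathbb R^I$ with at most finitely many non-zero components, and let $h:\Theta\to C_Z$ be convex (for the pointwise order) with $h(0)=0$. Let $G$ be the set of all $$\sum_{t=1}^T\sum_{j=1}^J\vartheta^j_t\,\Delta\tilde S^j_t+\sum_{i\in I}\theta_iH_i-h(\theta),$$ where $\theta\in\Theta$ and each $\vartheta^j_t:\Omega\to[0,\infty)$ is $\mathcal F_{t-1}$-measurable. Define $$\phi(X)=\inf\{m\in\mathbb R: m-X\in B^+-G\}\quad(\inf\emptyset=+\infty),\qquad \phi^*_G(\mathbb P)=\sup_{X\in G}\mathbb E^{\mathbb P}X\quad(\mathbb P\in\mathcal P_Z),$$ and $\mathcal M=\{\mathbb P\in\mathcal P_Z:\phi^*_G(\mathbb P)=0\}$. **Proposition 3.2.** For every $\mathbb P\in\mathcal P_Z$, $$\phi^*_G(\mathbb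 P)=\begin{cases}\sup_{\theta\in\Theta}\mathbb E^{\mathbb P}\big(\sum_{i\in I}\theta_iH_i-h(\theta)\big)&\text{if }\tilde S^1,\dots,\tilde S^J\text{ are }(\mathcal F_t)\text{-supermartingales under }\mathbb P,\\+\infty&\text{otherwise.}\end{cases}$$ If, moreover, for all integers $n\ge1$, all $j=1,\dots,J$ and all $t=1,\dots,T$ there exist $X\in G$ and $K\in\mathbb R_+$ such that $X\ge n\big((\tilde S^j_t)^p-K\big)^+-1/n$ on $\Omega$, then the following four conditions are equivalent: (i) there exist no $X\in G$ and $\varepsilon>0$ such that $X\ge\varepsilon$ on $\Omega$; (ii) there exists no $X\in G$ such that $X(\omega)>0$ for all $\omega\in\Omega$; (iii) $\mathcal M\ne\emptyset$; (iv) $\phi$ is real-valued on $B_Z$, $\phi(0)=0$, and for every $X\in U_Z$ $$\phi(X)=\max_{\mathbb P\in\mathcal P_Z}\big(\mathbb E^{\mathbb P}X-\phi^*_G(\mathbb P)\big),$$ the maximum being attained. -/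

import Mathlib

open MeasureTheory
open scoped Pointwise

noncomputable section

namespace ShortSelling

/-! A scenario is a path `ω` with `ω k j` the nominal price of asset `j` at time `k + 1`,
`k = 0, …, T - 1`. Asset `0` is the numeraire. `Ω` is the set of possible scenarios; it carries the
topology and the Borel sigma-algebra inherited from `ℝ ^ ((J + 1) T)`. -/

section Model

variable {J T : ℕ} {Ω : Set (Fin T → Fin (J + 1) → ℝ)}

/-- Nominal price of asset `j` at time `t = 0, …, T`: at time `0` it is the constant `1` for the
numeraire and `s₀ j` for the other assets, and afterwards it is read off the scenario. -/
def price (s₀ : Fin J → ℝ) (t : Fin (T + 1)) (j : Fin (J + 1)) (ω : Ω) : ℝ :=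
  Fin.cases (motive := fun _ => ℝ)
    (Fin.cases (motive := fun _ => ℝ) 1 s₀ j) (fun k => (ω : Fin T → Fin (J + 1) → ℝ) k j) t

/-- Price at time `t` of the `j`-th risky asset, in units of the numeraire. -/
def discPrice (s₀ : Fin J → ℝ) (t : Fin (T + 1)) (j : Fin J) (ω : Ω) : ℝ :=
  price s₀ t j.succ ω / price s₀ t 0 ω

theorem stronglyMeasurable_price (s₀ : Fin J → ℝ) (t : Fin (T + 1)) :
    StronglyMeasurable (fun (ω : Ω) (j : Fin (J + 1)) => price s₀ t j ω) := by
  apply Measurable.stronglyMeasurable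
  refine measurable_pi_lambda _ fun j => ?_
  refine Fin.cases ?_ (fun k => ?_) t
  · exact measurable_const
  · exact (measurable_pi_apply j).comp ((measurable_pi_apply k).comp measurable_subtype_coe)

/-- The filtration generated by the nominal prices of all assets. -/
def priceFiltration (Ω : Set (Fin T → Fin (J + 1) → ℝ)) (s₀ : Fin J → ℝ) :
    Filtration (Fin (T + 1)) (Subtype.instMeasurableSpace : MeasurableSpace Ω) :=
  Filtration.natural (fun t (ω : Ω) (j : Fin (J + 1)) => price s₀ t j ω)
    (stronglyMeasurable_price s₀)

/-- The growth function `Z`. -/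
def growth (s₀ : Fin J → ℝ) (p : ℝ) (ω : Ω) : ℝ :=
  1 + ∑ k : Fin T, ∑ j : Fin J, discPrice s₀ k.succ j ω ^ p

/-- The gain of dynamic trading. Here `ϑ k j` is the number of shares of the `j`-th risky asset held
from time `k` to time `k + 1`, `k = 0, …, T - 1`. -/
def dynGain (s₀ : Fin J → ℝ) (ϑ : Fin T → Fin J → Ω → ℝ) (ω : Ω) : ℝ :=
  ∑ k : Fin T, ∑ j : Fin J,
    ϑ k j ω * (discPrice s₀ k.succ j ω - discPrice s₀ k.castSucc j ω)

/-- Non-negative predictable strategies: the holdings from time `k` to time `k + 1` are known at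
time `k`. -/
def IsLongStrategy (s₀ : Fin J → ℝ) (ϑ : Fin T → Fin J → Ω → ℝ) : Prop :=
  ∀ k j, Measurable[priceFiltration Ω s₀ k.castSucc] (ϑ k j) ∧ ∀ ω, 0 ≤ ϑ k j ω

/-- The outcome of a static position `θ` (only finitely many non-zero components) in the
derivatives `H i`, net of the cost `h θ`. -/
def staticGain {I : Type*} (H : I → Ω → ℝ) (h : (I →₀ ℝ) → Ω → ℝ) (θ : I →₀ ℝ) (ω : Ω) : ℝ :=
  (θ.sum fun i c => c * H i ω) - h θ ω

/-- The set `G` of discounted trading gains. -/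
def gains {I : Type*} (s₀ : Fin J → ℝ) (H : I → Ω → ℝ) (Θ : Set (I →₀ ℝ))
    (h : (I →₀ ℝ) → Ω → ℝ) : Set (Ω → ℝ) :=
  {X | ∃ ϑ : Fin T → Fin J → Ω → ℝ, IsLongStrategy s₀ ϑ ∧ ∃ θ ∈ Θ,
    X = fun ω => dynGain s₀ ϑ ω + staticGain H h θ ω}

/-- Every risky discounted price is a supermartingale under `P`. -/
def IsSupermartingaleMeasure (s₀ : Fin J → ℝ) (P : ProbabilityMeasure Ω) : Prop :=
  ∀ j : Fin J, Supermartingale (fun t (ω : Ω) => discPrice s₀ t j ω) (priceFiltration Ω s₀)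
    (P : Measure Ω)

/-- For each `n ≥ 1`, each risky asset and each time, `n` calls on the `p`-th power of the
discounted price can be superhedged at cost `1 / n`, if the strike is large enough. -/
def CallCondition (s₀ : Fin J → ℝ) (p : ℝ) (G : Set (Ω → ℝ)) : Prop :=
  ∀ n : ℕ, 1 ≤ n → ∀ (j : Fin J) (k : Fin T), ∃ X ∈ G, ∃ K : ℝ, 0 ≤ K ∧
    ∀ ω, (n : ℝ) * max (discPrice s₀ k.succ j ω ^ p - K) 0 - 1 / (n : ℝ) ≤ X ω

end Model

section Functionals

variable {E : Type*} [MeasurableSpace E]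

/-- The cone `B⁺` of non-negative measurable functions. -/
def posCone (E : Type*) [MeasurableSpace E] : Set (E → ℝ) :=
  {X | Measurable X ∧ ∀ ω, 0 ≤ X ω}

/-- `B_Z`: measurable functions `X` with `X / Z` bounded. -/
def boundedBy (Z : E → ℝ) : Set (E → ℝ) :=
  {X | Measurable X ∧ ∃ C : ℝ, ∀ ω, |X ω / Z ω| ≤ C}

/-- `U_Z`: upper semicontinuous elements of `B_Z`. -/
def uscBoundedBy [TopologicalSpace E] (Z : E → ℝ) : Set (E → ℝ) :=
  {X | X ∈ boundedBy Z ∧ UpperSemicontinuous X}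

/-- `C_Z`: continuous elements of `B_Z`. -/
def contBoundedBy [TopologicalSpace E] (Z : E → ℝ) : Set (E → ℝ) :=
  {X | X ∈ boundedBy Z ∧ Continuous X}

/-- `P_Z`: probability measures that integrate `Z`. -/
def probInt (Z : E → ℝ) : Set (ProbabilityMeasure E) :=
  {P | Integrable Z (P : Measure E)}

open Classical in
/-- The extended expectation `E X⁺ - E X⁻`, set to `-∞` if `E X⁻ = +∞`. -/
def expect (P : ProbabilityMeasure E) (X : E → ℝ) : EReal :=
  if ∫⁻ ω, ENNReal.ofReal (-X ω) ∂(P : Measure E) < ⊤ then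
    ((∫⁻ ω, ENNReal.ofReal (X ω) ∂(P : Measure E) : ENNReal) : EReal)
      - ((∫⁻ ω, ENNReal.ofReal (-X ω) ∂(P : Measure E) : ENNReal) : EReal)
  else ⊥

/-- The superhedging functional for an acceptance set `A` and a set of gains `G`;
the infimum of the empty set is `+∞`. -/
def superhedge (A G : Set (E → ℝ)) (X : E → ℝ) : EReal :=
  sInf ((fun m : ℝ => (m : EReal)) '' {m : ℝ | (fun ω => m - X ω) ∈ A - G})

/-- The penalty `φ*_G(P) = sup_{X ∈ G} E^P X`. -/
def penalty (G : Set (E → ℝ)) (P : ProbabilityMeasure E) : EReal :=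
  ⨆ X ∈ G, expect P X

/-- The set `M` of generalized martingale measures. -/
def genMartMeasures (Z : E → ℝ) (G : Set (E → ℝ)) : Set (ProbabilityMeasure E) :=
  {P | P ∈ probInt Z ∧ penalty G P = 0}

end Functionals

end ShortSelling

end

noncomputable section

namespace ShortSelling

/-! The continuous, growth-dominated gains already determine the penalty: testing a measure of
finite penalty with arbitrarily large multiples of a nonnegative continuous function of the price
history up to time `k`, held in one asset over the next period, gives the supermartingale
inequality against that function, and such functions suffice. Under a supermartingale measure, on
the other hand, dynamic trading contributes nothing to the penalty.

For the equivalence, absence of arbitrage makes the superhedging cost a finite convex function on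
the functions dominated by `Z`. It has a subgradient at `X` by Hahn–Banach, which is a positive
functional because the cost is monotone, and has mass `1` because constants are hedged at their
value. The calls in `G` superhedge arbitrarily large multiples of the tail of `Z` at a bounded
cost, so the functional is tight and is represented on continuous functions by a measure, through
the Riesz theorem. Upper semicontinuity of `X` allows the passage from continuous functions to `X`,
so this measure attains the dual maximum. Conversely, a measure with zero penalty excludes
arbitrage. -/

open Set Filter Topology

section Subgradient

variable {V : Type*} [AddCommGroup V] [Module ℝ V]

theorem exists_subgradient {f : V → ℝ} (hf : ConvexOn ℝ univ f) (x : V) :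
    ∃ L : V →ₗ[ℝ] ℝ, ∀ y, f x + L (y - x) ≤ f y := by
  let epi : Set (V × ℝ) := {z | f (z.1 + x) ≤ z.2 + f x}
  have hepi : Convex ℝ epi := by
    simpa [epi, preimage] using hf.convex_epigraph.translate_preimage_left ((x, f x) : V × ℝ)
  have hsub : epi ⊆ ConvexCone.hull ℝ epi := ConvexCone.subset_hull
  have hne : ((0 : V), (1 : ℝ)) ≠ 0 := by simp
  -- The functional `(0, c) ↦ c` extends to one that is non-negative on the epigraph.
  obtain ⟨g, hg, hpos⟩ := riesz_extension
    ((ConvexCone.hull ℝ epi).toPointedCone (hsub (by simp [epi])))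
    (LinearPMap.mkSpanSingleton ((0 : V), (1 : ℝ)) (1 : ℝ) hne)
    (by
      rintro ⟨z, hz⟩ hcone
      obtain ⟨c, rfl⟩ := Submodule.mem_span_singleton.1 hz
      obtain ⟨k, hk, ⟨v, r⟩, hvr, heq⟩ := (ConvexCone.mem_hull_of_convex hepi).1 hcone
      obtain ⟨hv, hr⟩ : v = 0 ∧ k * r = c := by simpa [hk.ne'] using heq
      have hr0 : 0 ≤ r := by simpa [epi, hv] using hvr
      rw [LinearPMap.mkSpanSingleton'_apply, ← hr]
      simpa using mul_nonneg hk.le hr0)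
    (by
      rintro ⟨v, r⟩
      refine ⟨⟨(f (v + x) - f x - r) • (0, 1),
        Submodule.smul_mem _ _ (Submodule.mem_span_singleton_self _)⟩, hsub ?_⟩
      simp [epi])
  have hg1 : g (0, 1) = 1 := by
    rw [hg ⟨(0, 1), Submodule.mem_span_singleton_self _⟩]
    exact LinearPMap.mkSpanSingleton'_apply_self _ _ _ _
  refine ⟨-(g ∘ₗ LinearMap.inl ℝ V ℝ), fun y => ?_⟩
  have hy : 0 ≤ g (y - x, f y - f x) := hpos _ (hsub (by simp [epi]))
  have hsplit : ((y - x, f y - f x) : V × ℝ) = (y - x, 0) + (f y - f x) • (0, 1) := by simp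
  rw [hsplit, map_add, map_smul, hg1, smul_eq_mul, mul_one] at hy
  simp only [LinearMap.neg_apply, LinearMap.comp_apply, LinearMap.inl_apply]
  linarith

end Subgradient

section Dominated

variable {E : Type*} {Z : E → ℝ}

/-- The functions dominated by a multiple of `Z`, without any measurability requirement. -/
def dominatedBy (Z : E → ℝ) : Submodule ℝ (E → ℝ) where
  carrier := {X | X =O[⊤] Z}
  add_mem' := Asymptotics.IsBigO.add
  zero_mem' := Asymptotics.isBigO_zero _ _
  smul_mem' c _ hX := hX.const_smul_left c

theorem mem_dominatedBy_of_abs_le {X : E → ℝ} {C : ℝ} (hX : ∀ ω, |X ω| ≤ C * |Z ω|) :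
    X ∈ dominatedBy Z :=
  Asymptotics.isBigO_top.2 ⟨C, hX⟩

theorem exists_abs_le_of_mem_dominatedBy (hZ : 0 ≤ Z) {X : E → ℝ} (hX : X ∈ dominatedBy Z) :
    ∃ C, 0 ≤ C ∧ ∀ ω, |X ω| ≤ C * Z ω := by
  obtain ⟨C, hC, hbound⟩ := Asymptotics.IsBigO.exists_nonneg hX
  refine ⟨C, hC, fun ω => ?_⟩
  simpa [abs_of_nonneg (hZ ω)] using Asymptotics.isBigOWith_top.1 hbound ω

theorem mem_dominatedBy_of_abs_le_abs {X Y : E → ℝ} (hY : Y ∈ dominatedBy Z)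
    (h : ∀ ω, |X ω| ≤ |Y ω|) : X ∈ dominatedBy Z :=
  (Asymptotics.isBigO_of_le _ h).trans hY

theorem mul_mem_dominatedBy {u X : E → ℝ} {c : ℝ} (hu : ∀ ω, |u ω| ≤ c)
    (hX : X ∈ dominatedBy Z) : u * X ∈ dominatedBy Z :=
  mem_dominatedBy_of_abs_le_abs (Submodule.smul_mem _ c hX) fun ω => by
    simp only [Pi.mul_apply, Pi.smul_apply, smul_eq_mul, abs_mul]
    exact mul_le_mul_of_nonneg_right ((hu ω).trans (le_abs_self c)) (abs_nonneg _)

theorem self_mem_dominatedBy : Z ∈ dominatedBy Z := Asymptotics.isBigO_refl _ _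

theorem one_mem_dominatedBy (hZ : 1 ≤ Z) : (1 : E → ℝ) ∈ dominatedBy Z :=
  mem_dominatedBy_of_abs_le_abs self_mem_dominatedBy fun ω => by
    simpa using (hZ ω).trans (le_abs_self _)

/-- The part of `Z` above the level `R`. -/
def tailPart (Z : E → ℝ) (R : ℝ) : dominatedBy Z :=
  ⟨{ω | R < Z ω}.indicator Z, mem_dominatedBy_of_abs_le_abs self_mem_dominatedBy fun ω => by
    by_cases hω : R < Z ω <;> simp [indicator, hω]⟩

end Dominated

section Hedging

variable {E : Type*} {Z : E → ℝ} {G : Set (E → ℝ)}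

/-- The initial capitals from which `X` can be superhedged with a gain in `G`. -/
def hedgeCapital (G : Set (E → ℝ)) (X : E → ℝ) : Set ℝ :=
  {m | X - m • 1 ∈ lowerClosure G}

/-- The superhedging cost as a real number. The infimum has the junk value `0` when it is not
finite, which cannot happen for a hedging set and a dominated claim. -/
def hedgeCost (G : Set (E → ℝ)) (X : E → ℝ) : ℝ := sInf (hedgeCapital G X)

theorem mem_hedgeCapital {X : E → ℝ} {m : ℝ} :
    m ∈ hedgeCapital G X ↔ ∃ g ∈ G, ∀ ω, X ω ≤ m + g ω := by
  simp [hedgeCapital, Pi.le_def, add_comm]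

theorem hedgeCapital_anti {X Y : E → ℝ} (hXY : X ≤ Y) : hedgeCapital G Y ⊆ hedgeCapital G X :=
  fun _ hm => (lowerClosure G).lower (sub_le_sub_right hXY _) hm

theorem add_mem_hedgeCapital_add_const {X : E → ℝ} {m : ℝ} (hm : m ∈ hedgeCapital G X) (c : ℝ) :
    m + c ∈ hedgeCapital G (X + c • 1) := by
  have hshift : X + c • 1 - (m + c) • (1 : E → ℝ) = X - m • 1 := by module
  change X + c • 1 - (m + c) • (1 : E → ℝ) ∈ lowerClosure G
  rwa [hshift]

/-- An arbitrage-free set of gains which is convex up to free disposal and superhedges arbitrarily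
large multiples of the tail of `Z` at unit cost. -/
structure IsHedgingSet (Z : E → ℝ) (G : Set (E → ℝ)) : Prop where
  one_le : 1 ≤ Z
  zero_mem : 0 ∈ G
  convex : Convex ℝ (lowerClosure G : Set (E → ℝ))
  noArbitrage : ∀ ε > (0 : ℝ), ε • 1 ∉ lowerClosure G
  tail : ∀ c : ℝ, ∃ R, 1 ∈ hedgeCapital G (c • (tailPart Z R : E → ℝ))

namespace IsHedgingSet

theorem nonneg (hG : IsHedgingSet Z G) : 0 ≤ Z := zero_le_one.trans hG.one_le

theorem combo_mem_hedgeCapital (hG : IsHedgingSet Z G) {X Y : E → ℝ} {m n : ℝ}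
    (hm : m ∈ hedgeCapital G X) (hn : n ∈ hedgeCapital G Y) {a b : ℝ} (ha : 0 ≤ a) (hb : 0 ≤ b)
    (hab : a + b = 1) : a * m + b * n ∈ hedgeCapital G (a • X + b • Y) := by
  have hsplit : a • X + b • Y - (a * m + b * n) • (1 : E → ℝ)
      = a • (X - m • 1) + b • (Y - n • 1) := by module
  change a • X + b • Y - (a * m + b * n) • (1 : E → ℝ) ∈ lowerClosure G
  rw [hsplit]
  exact hG.convex hm hn ha hb hab

theorem nonneg_of_mem_hedgeCapital_zero (hG : IsHedgingSet Z G) {m : ℝ}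
    (hm : m ∈ hedgeCapital G 0) : 0 ≤ m := by
  by_contra! hneg
  refine hG.noArbitrage (-m) (by linarith) ?_
  rw [neg_smul, ← zero_sub]
  exact hm

theorem hedgeCapital_nonempty (hG : IsHedgingSet Z G) {X : E → ℝ} (hX : X ∈ dominatedBy Z) :
    (hedgeCapital G X).Nonempty := by
  obtain ⟨C, hC0, hC⟩ := exists_abs_le_of_mem_dominatedBy hG.nonneg hX
  obtain ⟨R, htail⟩ := hG.tail C
  refine ⟨1 + C * |R|, hedgeCapital_anti (fun ω => ?_)
    (add_mem_hedgeCapital_add_const htail (C * |R|))⟩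
  refine ((le_abs_self _).trans (hC ω)).trans ?_
  change C * Z ω ≤ C * {ω | R < Z ω}.indicator Z ω + C * |R| * 1
  rw [mul_one, ← mul_add]
  gcongr
  by_cases hR : R < Z ω
  · rw [indicator_of_mem (show ω ∈ {ω | R < Z ω} from hR)]
    exact le_add_of_nonneg_right (abs_nonneg R)
  · rw [indicator_of_notMem (show ω ∉ {ω | R < Z ω} from hR), zero_add]
    exact (not_lt.1 hR).trans (le_abs_self R)

theorem add_nonneg_of_mem_hedgeCapital_neg (hG : IsHedgingSet Z G) {X : E → ℝ} {m n : ℝ}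
    (hm : m ∈ hedgeCapital G X) (hn : n ∈ hedgeCapital G (-X)) : 0 ≤ m + n := by
  have hmid := hG.combo_mem_hedgeCapital hm hn (a := 1 / 2) (b := 1 / 2) (by norm_num)
    (by norm_num) (by norm_num)
  rw [smul_neg, add_neg_cancel] at hmid
  linarith [hG.nonneg_of_mem_hedgeCapital_zero hmid]

theorem hedgeCapital_bddBelow (hG : IsHedgingSet Z G) {X : E → ℝ} (hX : X ∈ dominatedBy Z) :
    BddBelow (hedgeCapital G X) := by
  obtain ⟨n, hn⟩ := hG.hedgeCapital_nonempty (neg_mem hX)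
  exact ⟨-n, fun m hm => by linarith [hG.add_nonneg_of_mem_hedgeCapital_neg hm hn]⟩

theorem cost_le (hG : IsHedgingSet Z G) {X : E → ℝ} (hX : X ∈ dominatedBy Z) {m : ℝ}
    (hm : m ∈ hedgeCapital G X) : hedgeCost G X ≤ m :=
  csInf_le (hG.hedgeCapital_bddBelow hX) hm

theorem cost_mono (hG : IsHedgingSet Z G) {X Y : dominatedBy Z} (h : X ≤ Y) :
    hedgeCost G X ≤ hedgeCost G Y :=
  csInf_le_csInf (hG.hedgeCapital_bddBelow X.2) (hG.hedgeCapital_nonempty Y.2)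
    (hedgeCapital_anti h)

theorem cost_gain_nonpos (hG : IsHedgingSet Z G) {g : E → ℝ} (hg : g ∈ G)
    (hgZ : g ∈ dominatedBy Z) : hedgeCost G g ≤ 0 :=
  hG.cost_le hgZ (mem_hedgeCapital.2 ⟨g, hg, fun ω => by simp⟩)

theorem cost_zero (hG : IsHedgingSet Z G) : hedgeCost G 0 = 0 :=
  (hG.cost_gain_nonpos hG.zero_mem (Submodule.zero_mem _)).antisymm <|
    le_csInf (hG.hedgeCapital_nonempty (Submodule.zero_mem _))
      fun _ => hG.nonneg_of_mem_hedgeCapital_zero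

theorem cost_add_const_le (hG : IsHedgingSet Z G) {X : E → ℝ} (hX : X ∈ dominatedBy Z) (c : ℝ) :
    hedgeCost G (X + c • 1) ≤ hedgeCost G X + c := by
  have hXc : X + c • 1 ∈ dominatedBy Z :=
    add_mem hX (Submodule.smul_mem _ c (one_mem_dominatedBy hG.one_le))
  rw [← sub_le_iff_le_add]
  refine le_csInf (hG.hedgeCapital_nonempty hX) fun m hm => ?_
  exact sub_le_iff_le_add.2 (hG.cost_le hXc (add_mem_hedgeCapital_add_const hm c))

theorem convexOn_cost (hG : IsHedgingSet Z G) :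
    ConvexOn ℝ univ fun X : dominatedBy Z => hedgeCost G X := by
  refine ⟨convex_univ, fun X _ Y _ a b ha hb hab => le_of_forall_pos_le_add fun ε hε => ?_⟩
  obtain ⟨m, hm, hmε⟩ :=
    exists_lt_of_csInf_lt (hG.hedgeCapital_nonempty X.2) (lt_add_of_pos_right _ hε)
  obtain ⟨n, hn, hnε⟩ :=
    exists_lt_of_csInf_lt (hG.hedgeCapital_nonempty Y.2) (lt_add_of_pos_right _ hε)
  calc hedgeCost G (a • X + b • Y : dominatedBy Z) ≤ a * m + b * n :=
        hG.cost_le (Subtype.prop _) (hG.combo_mem_hedgeCapital hm hn ha hb hab)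
    _ ≤ a * (hedgeCost G X + ε) + b * (hedgeCost G Y + ε) := by
        gcongr
        exacts [hmε.le, hnε.le]
    _ = a • hedgeCost G X + b • hedgeCost G Y + (a + b) * ε := by simp only [smul_eq_mul]; ring
    _ = a • hedgeCost G X + b • hedgeCost G Y + ε := by rw [hab, one_mul]

theorem exists_positive_subgradient (hG : IsHedgingSet Z G) (X : dominatedBy Z) :
    ∃ L : dominatedBy Z →ₚ[ℝ] ℝ, L ⟨1, one_mem_dominatedBy hG.one_le⟩ = 1 ∧
      ∀ Y : dominatedBy Z, hedgeCost G X + L (Y - X) ≤ hedgeCost G Y := by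
  obtain ⟨L, hL⟩ := exists_subgradient hG.convexOn_cost X
  have hpos : ∀ Y, 0 ≤ Y → 0 ≤ L Y := fun Y hY => by
    have hsub := hL (X - Y)
    rw [sub_sub_cancel_left, map_neg] at hsub
    linarith [hG.cost_mono (sub_le_self X hY)]
  let u : dominatedBy Z := ⟨1, one_mem_dominatedBy hG.one_le⟩
  have hconst : ∀ c : ℝ, c * L u ≤ c := fun c => by
    have hsub := hL (X + c • u)
    rw [add_sub_cancel_left, map_smul, smul_eq_mul] at hsub
    have hshift : hedgeCost G (X + c • u : dominatedBy Z) ≤ hedgeCost G X + c :=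
      hG.cost_add_const_le X.2 c
    linarith
  refine ⟨.mk₀ L hpos, ?_, hL⟩
  change L u = 1
  linarith [hconst 1, hconst (-1)]

theorem exists_tailPart_le (hG : IsHedgingSet Z G) {X : dominatedBy Z}
    {L : dominatedBy Z →ₚ[ℝ] ℝ} (hL : ∀ Y, hedgeCost G X + L (Y - X) ≤ hedgeCost G Y) {ε : ℝ}
    (hε : 0 < ε) : ∃ R, L (tailPart Z R) ≤ ε := by
  -- `X + c • tail` is the midpoint of `2 • X` and `2 * c • tail`, whose costs do not depend on `c`.
  set B : ℝ := 1 / 2 * hedgeCost G ((2 : ℝ) • X : dominatedBy Z) + 1 / 2 - hedgeCost G X with hB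
  have hc : 0 < (|B| + 1) / ε := by positivity
  set c : ℝ := (|B| + 1) / ε with hc_def
  obtain ⟨R, htail⟩ := hG.tail (2 * c)
  refine ⟨R, le_of_mul_le_mul_left ?_ hc⟩
  have hmid : (1 / 2 : ℝ) • (2 : ℝ) • X + (1 / 2 : ℝ) • (2 * c) • tailPart Z R
      = X + c • tailPart Z R := by module
  have hconv := hG.convexOn_cost.2 (mem_univ ((2 : ℝ) • X)) (mem_univ ((2 * c) • tailPart Z R))
    one_half_pos.le one_half_pos.le (add_halves 1)
  have hcost : hedgeCost G ((2 * c) • tailPart Z R : dominatedBy Z) ≤ 1 :=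
    hG.cost_le (Subtype.prop _) htail
  have hsub := hL (X + c • tailPart Z R)
  rw [add_sub_cancel_left, map_smul, smul_eq_mul] at hsub
  simp only [hmid, smul_eq_mul] at hconv
  calc c * L (tailPart Z R) ≤ B := by linarith
    _ ≤ |B| + 1 := by linarith [le_abs_self B]
    _ = c * ε := by rw [hc_def, div_mul_cancel₀ _ hε.ne']

end IsHedgingSet

end Hedging

section Representation

variable {E : Type*} {Z : E → ℝ}

/-- A cutoff function equal to `1` on `Z ≤ n` and to `0` on `Z ≥ n + 1`. -/
def cutoff (Z : E → ℝ) (n : ℕ) (ω : E) : ℝ := max 0 (min 1 (n + 1 - Z ω))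

theorem cutoff_mem_Icc (n : ℕ) (ω : E) : cutoff Z n ω ∈ Icc 0 1 :=
  ⟨le_max_left _ _, max_le zero_le_one (min_le_left _ _)⟩

theorem cutoff_eq_one {n : ℕ} {ω : E} (h : Z ω ≤ n) : cutoff Z n ω = 1 := by
  rw [cutoff, min_eq_left (by linarith), max_eq_right zero_le_one]

theorem cutoff_eq_zero {n : ℕ} {ω : E} (h : n + 1 ≤ Z ω) : cutoff Z n ω = 0 :=
  max_eq_left ((min_le_right _ _).trans (by linarith))

theorem abs_mul_cutoff_le (Y : E → ℝ) (n : ℕ) (ω : E) : |Y ω * cutoff Z n ω| ≤ |Y ω| := by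
  obtain ⟨h0, h1⟩ := cutoff_mem_Icc (Z := Z) n ω
  rw [abs_mul, abs_of_nonneg h0]
  exact mul_le_of_le_one_right (abs_nonneg _) h1

/-- The truncation of a dominated function to (a neighbourhood of) the sublevel set `Z ≤ n`. -/
def truncate (Y : dominatedBy Z) (n : ℕ) : dominatedBy Z :=
  ⟨fun ω => Y.1 ω * cutoff Z n ω, mem_dominatedBy_of_abs_le_abs Y.2 (abs_mul_cutoff_le Y.1 n)⟩

theorem tendsto_truncate (Y : dominatedBy Z) (ω : E) :
    Tendsto (fun n => (truncate Y n).1 ω) atTop (𝓝 (Y.1 ω)) := by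
  obtain ⟨N, hN⟩ := exists_nat_ge (Z ω)
  refine tendsto_const_nhds.congr' ?_
  filter_upwards [eventually_ge_atTop N] with n hn
  change Y.1 ω = Y.1 ω * cutoff Z n ω
  rw [cutoff_eq_one (hN.trans (by exact_mod_cast hn)), mul_one]

theorem abs_map_le (L : dominatedBy Z →ₚ[ℝ] ℝ) {Y W : dominatedBy Z}
    (h : ∀ ω, |Y.1 ω| ≤ W.1 ω) : |L Y| ≤ L W := by
  rw [abs_le, ← map_neg]
  exact ⟨OrderHomClass.mono L fun ω => (abs_le.1 (h ω)).1,
    OrderHomClass.mono L fun ω => (abs_le.1 (h ω)).2⟩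

theorem tailPart_nonneg (hZ : 0 ≤ Z) (R : ℝ) : 0 ≤ tailPart Z R :=
  fun _ => indicator_nonneg (fun ω _ => hZ ω) _

theorem tailPart_anti (hZ : 0 ≤ Z) : Antitone (tailPart Z) := fun _ _ hRS _ =>
  indicator_le_indicator_of_subset (fun _ hω => hRS.trans_lt hω) (fun ω => hZ ω) _

theorem tendsto_map_tailPart (hZ : 0 ≤ Z) {L : dominatedBy Z →ₚ[ℝ] ℝ}
    (htail : ∀ ε > 0, ∃ R, L (tailPart Z R) ≤ ε) :
    Tendsto (fun n : ℕ => L (tailPart Z n)) atTop (𝓝 0) := by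
  refine tendsto_order.2 ⟨fun c hc => Eventually.of_forall fun n => hc.trans_le ?_, fun c hc => ?_⟩
  · simpa using OrderHomClass.mono L (tailPart_nonneg hZ n)
  · obtain ⟨R, hR⟩ := htail (c / 2) (half_pos hc)
    filter_upwards [tendsto_natCast_atTop_atTop.eventually_ge_atTop R] with n hn
    exact ((OrderHomClass.mono L (tailPart_anti hZ hn)).trans hR).trans_lt (half_lt_self hc)

theorem tendsto_map_truncate (hZ : 0 ≤ Z) {L : dominatedBy Z →ₚ[ℝ] ℝ}
    (htail : ∀ ε > 0, ∃ R, L (tailPart Z R) ≤ ε) (Y : dominatedBy Z) :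
    Tendsto (fun n => L (truncate Y n)) atTop (𝓝 (L Y)) := by
  obtain ⟨C, -, hC⟩ := exists_abs_le_of_mem_dominatedBy hZ Y.2
  have hrem : ∀ (n : ℕ) ω, |(truncate Y n - Y).1 ω| ≤ (C • tailPart Z n).1 ω := fun n ω => by
    change |Y.1 ω * cutoff Z n ω - Y.1 ω| ≤ C * {ω | n < Z ω}.indicator Z ω
    by_cases hω : (n : ℝ) < Z ω
    · obtain ⟨h0, h1⟩ := cutoff_mem_Icc (Z := Z) n ω
      rw [indicator_of_mem (show ω ∈ {ω | n < Z ω} from hω), ← mul_sub_one, abs_mul]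
      refine (mul_le_of_le_one_right (abs_nonneg _) ?_).trans (hC ω)
      exact abs_le.2 ⟨by linarith, by linarith⟩
    · rw [indicator_of_notMem (show ω ∉ {ω | n < Z ω} from hω), cutoff_eq_one (not_lt.1 hω)]
      simp
  rw [tendsto_iff_norm_sub_tendsto_zero]
  refine squeeze_zero (fun _ => norm_nonneg _) (fun n => ?_)
    (by simpa using (tendsto_map_tailPart hZ htail).const_mul C)
  rw [← map_sub, ← smul_eq_mul, ← map_smul]
  exact abs_map_le L (hrem n)

variable [TopologicalSpace E]

theorem continuous_truncate (hZ : Continuous Z) {Y : dominatedBy Z} (hY : Continuous Y.1) (n : ℕ) :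
    Continuous (truncate Y n).1 :=
  hY.mul (continuous_const.max (continuous_const.min (continuous_const.sub hZ)))

theorem hasCompactSupport_truncate [T2Space E] (hK : ∀ R : ℝ, IsCompact {ω | Z ω ≤ R})
    (Y : dominatedBy Z) (n : ℕ) : HasCompactSupport (truncate Y n).1 :=
  HasCompactSupport.intro (hK (n + 1)) fun ω hω => by
    change Y.1 ω * cutoff Z n ω = 0
    rw [cutoff_eq_zero (not_le.1 hω).le, mul_zero]

theorem mem_dominatedBy_of_hasCompactSupport (h1 : 1 ≤ Z) {Y : E → ℝ} (hY : Continuous Y)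
    (hc : HasCompactSupport Y) : Y ∈ dominatedBy Z := by
  obtain ⟨C, hC⟩ := hc.exists_bound_of_continuous hY
  refine mem_dominatedBy_of_abs_le_abs (Submodule.smul_mem _ C (one_mem_dominatedBy h1)) fun ω => ?_
  simpa using (hC ω).trans (le_abs_self C)

/-- The restriction of a positive functional to compactly supported continuous functions. -/
def restrictCc (h1 : 1 ≤ Z) (L : dominatedBy Z →ₚ[ℝ] ℝ) :
    CompactlySupportedContinuousMap E ℝ →ₚ[ℝ] ℝ :=
  PositiveLinearMap.mk₀
    { toFun f := L ⟨f, mem_dominatedBy_of_hasCompactSupport h1 f.1.continuous f.hasCompactSupport⟩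
      map_add' f g := by rw [← map_add]; rfl
      map_smul' c f := by rw [RingHom.id_apply, ← map_smul]; rfl }
    fun f hf => (map_zero L).symm.trans_le (OrderHomClass.mono L hf)

variable [T2Space E] [LocallyCompactSpace E] [MeasurableSpace E] [BorelSpace E]

/-- The measure representing a positive functional on compactly supported continuous functions. -/
def reprMeasure (h1 : 1 ≤ Z) (L : dominatedBy Z →ₚ[ℝ] ℝ) : Measure E :=
  RealRMK.rieszMeasure (restrictCc h1 L)

instance regular_reprMeasure (h1 : 1 ≤ Z) (L : dominatedBy Z →ₚ[ℝ] ℝ) :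
    (reprMeasure h1 L).Regular :=
  RealRMK.regular_rieszMeasure _

theorem integral_truncate_reprMeasure (hZ : Continuous Z) (h1 : 1 ≤ Z)
    (hK : ∀ R : ℝ, IsCompact {ω | Z ω ≤ R}) (L : dominatedBy Z →ₚ[ℝ] ℝ) {Y : dominatedBy Z}
    (hY : Continuous Y.1) (n : ℕ) :
    ∫ ω, (truncate Y n).1 ω ∂(reprMeasure h1 L) = L (truncate Y n) :=
  RealRMK.integral_rieszMeasure (restrictCc h1 L)
    ⟨⟨_, continuous_truncate hZ hY n⟩, hasCompactSupport_truncate hK Y n⟩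

theorem integrable_reprMeasure (hZ : Continuous Z) (h1 : 1 ≤ Z)
    (hK : ∀ R : ℝ, IsCompact {ω | Z ω ≤ R}) (L : dominatedBy Z →ₚ[ℝ] ℝ) :
    Integrable Z (reprMeasure h1 L) := by
  have h0 : 0 ≤ Z := zero_le_one.trans h1
  let Zd : dominatedBy Z := ⟨Z, self_mem_dominatedBy⟩
  have hcut : ∀ n ω, (truncate Zd n).1 ω ∈ Icc 0 (Z ω) := fun n ω =>
    have hc := cutoff_mem_Icc (Z := Z) n ω
    ⟨mul_nonneg (h0 ω) hc.1, mul_le_of_le_one_right (h0 ω) hc.2⟩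
  have hcover : AECover (reprMeasure h1 L) atTop fun n : ℕ => {ω | Z ω ≤ n} :=
    ⟨Eventually.of_forall fun ω => (eventually_ge_atTop ⌈Z ω⌉₊).mono fun n hn =>
      (Nat.le_ceil (Z ω)).trans (Nat.cast_le.2 hn),
      fun n => measurableSet_le hZ.measurable measurable_const⟩
  refine hcover.integrable_of_integral_norm_bounded (L Zd)
    (fun n => hZ.continuousOn.integrableOn_compact (hK n)) (Eventually.of_forall fun n => ?_)
  have hint : Integrable (truncate Zd n).1 (reprMeasure h1 L) :=
    (continuous_truncate hZ hZ n).integrable_of_hasCompactSupport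
      (hasCompactSupport_truncate hK Zd n)
  have hmeas : MeasurableSet {ω | Z ω ≤ n} := (hK n).measurableSet
  calc ∫ ω in {ω | Z ω ≤ n}, ‖Z ω‖ ∂(reprMeasure h1 L)
      = ∫ ω in {ω | Z ω ≤ n}, (truncate Zd n).1 ω ∂(reprMeasure h1 L) :=
        setIntegral_congr_fun hmeas fun ω hω => by
          change |Z ω| = Z ω * cutoff Z n ω
          rw [cutoff_eq_one hω, mul_one, abs_of_nonneg (h0 ω)]
    _ ≤ ∫ ω, (truncate Zd n).1 ω ∂(reprMeasure h1 L) :=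
        setIntegral_le_integral hint (Eventually.of_forall fun ω => (hcut n ω).1)
    _ = L (truncate Zd n) := integral_truncate_reprMeasure hZ h1 hK L hZ n
    _ ≤ L Zd := OrderHomClass.mono L fun ω => (hcut n ω).2

theorem integral_reprMeasure (hZ : Continuous Z) (h1 : 1 ≤ Z)
    (hK : ∀ R : ℝ, IsCompact {ω | Z ω ≤ R}) {L : dominatedBy Z →ₚ[ℝ] ℝ}
    (htail : ∀ ε > 0, ∃ R, L (tailPart Z R) ≤ ε) {Y : dominatedBy Z} (hY : Continuous Y.1) :
    ∫ ω, Y.1 ω ∂(reprMeasure h1 L) = L Y := by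
  have h0 : 0 ≤ Z := zero_le_one.trans h1
  obtain ⟨C, -, hC⟩ := exists_abs_le_of_mem_dominatedBy h0 Y.2
  refine tendsto_nhds_unique ?_ (tendsto_map_truncate h0 htail Y)
  simp_rw [← integral_truncate_reprMeasure hZ h1 hK L hY]
  exact tendsto_integral_of_dominated_convergence (fun ω => C * Z ω)
    (fun n => (continuous_truncate hZ hY n).aestronglyMeasurable)
    ((integrable_reprMeasure hZ h1 hK L).const_mul C)
    (fun n => Eventually.of_forall fun ω => (abs_mul_cutoff_le Y.1 n ω).trans (hC ω))
    (Eventually.of_forall (tendsto_truncate Y))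

theorem exists_probabilityMeasure (hZ : Continuous Z) (h1 : 1 ≤ Z)
    (hK : ∀ R : ℝ, IsCompact {ω | Z ω ≤ R}) {L : dominatedBy Z →ₚ[ℝ] ℝ}
    (hL1 : L ⟨1, one_mem_dominatedBy h1⟩ = 1) (htail : ∀ ε > 0, ∃ R, L (tailPart Z R) ≤ ε) :
    ∃ P : ProbabilityMeasure E, Integrable Z (P : Measure E) ∧
      ∀ Y : dominatedBy Z, Continuous Y.1 → ∫ ω, Y.1 ω ∂(P : Measure E) = L Y := by
  have hprob : IsProbabilityMeasure (reprMeasure h1 L) := by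
    have hone := integral_reprMeasure hZ h1 hK htail
      (Y := ⟨1, one_mem_dominatedBy h1⟩) continuous_const
    simp only [Pi.one_apply, integral_const, hL1, smul_eq_mul, mul_one] at hone
    exact ⟨(ENNReal.toReal_eq_one_iff _).1 hone⟩
  exact ⟨⟨_, hprob⟩, integrable_reprMeasure hZ h1 hK L,
    fun Y hY => integral_reprMeasure hZ h1 hK htail hY⟩

end Representation

section UpperEnvelope

variable {E : Type*} [PseudoMetricSpace E]

/-- The smallest `n`-Lipschitz majorant of `f`, provided that `f` is bounded above. -/
def lipEnvelope (f : E → ℝ) (n : ℝ) (x : E) : ℝ := ⨆ y, (f y - n * dist x y)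

theorem lipEnvelope_le {f : E → ℝ} {n : ℝ} {x : E} {c : ℝ} (h : ∀ y, f y - n * dist x y ≤ c) :
    lipEnvelope f n x ≤ c :=
  have : Nonempty E := ⟨x⟩
  ciSup_le h

theorem sub_mul_dist_le_lipEnvelope {f : E → ℝ} (hf : f ≤ 0) {n : ℝ} (hn : 0 ≤ n) (x y : E) :
    f y - n * dist x y ≤ lipEnvelope f n x :=
  le_ciSup (f := fun y => f y - n * dist x y)
    ⟨0, forall_mem_range.2 fun z => sub_nonpos.2 ((hf z).trans (by positivity))⟩ y

theorem le_lipEnvelope {f : E → ℝ} (hf : f ≤ 0) {n : ℝ} (hn : 0 ≤ n) : f ≤ lipEnvelope f n :=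
  fun x => by simpa using sub_mul_dist_le_lipEnvelope hf hn x x

theorem lipEnvelope_nonpos {f : E → ℝ} (hf : f ≤ 0) {n : ℝ} (hn : 0 ≤ n) : lipEnvelope f n ≤ 0 :=
  fun _ => lipEnvelope_le fun y => sub_nonpos.2 ((hf y).trans (by positivity))

theorem continuous_lipEnvelope {f : E → ℝ} (hf : f ≤ 0) {n : ℝ} (hn : 0 ≤ n) :
    Continuous (lipEnvelope f n) := by
  refine (LipschitzWith.of_le_add_mul n.toNNReal fun x z => lipEnvelope_le fun y => ?_).continuous
  rw [Real.coe_toNNReal n hn]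
  have htri : n * dist z y ≤ n * (dist z x + dist x y) := by gcongr; exact dist_triangle z x y
  rw [dist_comm z x] at htri
  linarith [sub_mul_dist_le_lipEnvelope hf hn z y]

theorem tendsto_lipEnvelope {f : E → ℝ} (hu : UpperSemicontinuous f) (hf : f ≤ 0) (x : E) :
    Tendsto (fun n : ℕ => lipEnvelope f n x) atTop (𝓝 (f x)) := by
  refine tendsto_order.2 ⟨fun c hc => Eventually.of_forall fun n =>
    hc.trans_le (le_lipEnvelope hf n.cast_nonneg x), fun c hc => ?_⟩
  obtain ⟨d, hfd, hdc⟩ := exists_between hc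
  obtain ⟨δ, hδ, hball⟩ := Metric.eventually_nhds_iff.1 (hu x d hfd)
  obtain ⟨N, hN⟩ := exists_nat_ge (-d / δ)
  filter_upwards [eventually_ge_atTop N] with n hn
  refine (lipEnvelope_le fun y => ?_).trans_lt hdc
  rcases lt_or_ge (dist y x) δ with h | h
  · exact (sub_le_self _ (by positivity)).trans (hball h).le
  · have hfar : -d ≤ n * dist x y := calc
      -d ≤ N * δ := (div_le_iff₀ hδ).1 hN
      _ ≤ n * dist x y := by rw [dist_comm]; gcongr
    linarith [show f y ≤ 0 from hf y]

end UpperEnvelope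

section Duality

variable {E : Type*} {Z : E → ℝ} [MeasurableSpace E]

theorem integrable_of_mem_dominatedBy {P : Measure E} (hP : Integrable Z P) {X : E → ℝ}
    (hX : X ∈ dominatedBy Z) (hXm : Measurable X) : Integrable X P := by
  obtain ⟨C, hC⟩ := Asymptotics.isBigO_top.1 hX
  exact (hP.norm.const_mul C).mono' hXm.aestronglyMeasurable (Eventually.of_forall hC)

variable [PseudoMetricSpace E] [BorelSpace E]

theorem map_le_integral_of_nonpos {P : Measure E} (hP : Integrable Z P)
    {L : dominatedBy Z →ₚ[ℝ] ℝ} (hrep : ∀ Y : dominatedBy Z, Continuous Y.1 → ∫ ω, Y.1 ω ∂P = L Y)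
    {Y : dominatedBy Z} (hu : UpperSemicontinuous Y.1) (hY : Y.1 ≤ 0) :
    L Y ≤ ∫ ω, Y.1 ω ∂P := by
  have habs : ∀ (n : ℕ) ω, |lipEnvelope Y.1 n ω| ≤ |Y.1 ω| := fun n ω =>
    abs_le_abs_of_nonpos (lipEnvelope_nonpos hY n.cast_nonneg ω) (le_lipEnvelope hY n.cast_nonneg ω)
  refine ge_of_tendsto' (tendsto_integral_of_dominated_convergence (fun ω => |Y.1 ω|)
    (fun n => (continuous_lipEnvelope hY n.cast_nonneg).aestronglyMeasurable)
    (integrable_of_mem_dominatedBy hP Y.2 hu.measurable).abs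
    (fun n => Eventually.of_forall (habs n)) (Eventually.of_forall (tendsto_lipEnvelope hu hY)))
    fun n => ?_
  rw [hrep ⟨_, mem_dominatedBy_of_abs_le_abs Y.2 (habs n)⟩
    (continuous_lipEnvelope hY n.cast_nonneg)]
  exact OrderHomClass.mono L (le_lipEnvelope hY n.cast_nonneg)

theorem map_le_integral (hZ : Continuous Z) (h0 : 0 ≤ Z) {P : Measure E} (hP : Integrable Z P)
    {L : dominatedBy Z →ₚ[ℝ] ℝ} (hrep : ∀ Y : dominatedBy Z, Continuous Y.1 → ∫ ω, Y.1 ω ∂P = L Y)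
    {X : dominatedBy Z} (hu : UpperSemicontinuous X.1) : L X ≤ ∫ ω, X.1 ω ∂P := by
  obtain ⟨C, -, hC⟩ := exists_abs_le_of_mem_dominatedBy h0 X.2
  let CZ : dominatedBy Z := C • ⟨Z, self_mem_dominatedBy⟩
  have hCZ : Continuous CZ.1 := continuous_const.mul hZ
  have hsub : L (X - CZ) ≤ ∫ ω, (X - CZ).1 ω ∂P :=
    map_le_integral_of_nonpos hP hrep
      (sub_eq_add_neg X CZ ▸ hu.add hCZ.neg.upperSemicontinuous)
      fun ω => sub_nonpos.2 ((le_abs_self _).trans (hC ω))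
  have hint : ∫ ω, (X - CZ).1 ω ∂P = ∫ ω, X.1 ω ∂P - L CZ := by
    rw [← hrep CZ hCZ]
    exact integral_sub (integrable_of_mem_dominatedBy hP X.2 hu.measurable)
      (integrable_of_mem_dominatedBy hP CZ.2 hCZ.measurable)
  rw [map_sub] at hsub
  linarith

theorem IsHedgingSet.exists_dual [T2Space E] [LocallyCompactSpace E] {G : Set (E → ℝ)}
    (hG : IsHedgingSet Z G) (hZ : Continuous Z) (hK : ∀ R : ℝ, IsCompact {ω | Z ω ≤ R})
    {X : E → ℝ} (hX : X ∈ dominatedBy Z) (hu : UpperSemicontinuous X) :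
    ∃ P : ProbabilityMeasure E, Integrable Z (P : Measure E) ∧
      ∀ g ∈ G, Continuous g → g ∈ dominatedBy Z →
        ∫ ω, g ω ∂(P : Measure E) ≤ ∫ ω, X ω ∂(P : Measure E) - hedgeCost G X := by
  obtain ⟨L, hL1, hL⟩ := hG.exists_positive_subgradient ⟨X, hX⟩
  obtain ⟨P, hP, hrep⟩ := exists_probabilityMeasure hZ hG.one_le hK hL1
    fun ε hε => hG.exists_tailPart_le hL hε
  refine ⟨P, hP, fun g hg hgc hgZ => ?_⟩
  have hXle : L ⟨X, hX⟩ ≤ ∫ ω, X ω ∂(P : Measure E) :=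
    map_le_integral hZ hG.nonneg hP hrep (X := ⟨X, hX⟩) hu
  have hsub : hedgeCost G X + L (⟨g, hgZ⟩ - ⟨X, hX⟩) ≤ hedgeCost G g := hL ⟨g, hgZ⟩
  rw [map_sub, ← hrep ⟨g, hgZ⟩ hgc] at hsub
  linarith [hG.cost_gain_nonpos hg hgZ]

end Duality

section Expectation

variable {E : Type*} [MeasurableSpace E]

theorem expect_of_integrable (P : ProbabilityMeasure E) {X : E → ℝ}
    (hX : Integrable X (P : Measure E)) :
    expect P X = ((∫ ω, X ω ∂(P : Measure E) : ℝ) : EReal) := by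
  have h1 : ∫⁻ ω, ENNReal.ofReal (X ω) ∂(P : Measure E) < ⊤ := hX.lintegral_lt_top
  have h2 : ∫⁻ ω, ENNReal.ofReal (-X ω) ∂(P : Measure E) < ⊤ := hX.neg.lintegral_lt_top
  rw [expect, if_pos h2, integral_eq_lintegral_pos_part_sub_lintegral_neg_part hX, EReal.coe_sub,
    EReal.coe_ennreal_toReal h1.ne, EReal.coe_ennreal_toReal h2.ne]

theorem expect_eq_bot {P : ProbabilityMeasure E} {X : E → ℝ}
    (h : ¬ ∫⁻ ω, ENNReal.ofReal (-X ω) ∂(P : Measure E) < ⊤) : expect P X = ⊥ := by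
  rw [expect, if_neg h]

theorem expect_mono_of_integrable {P : ProbabilityMeasure E} {X Y : E → ℝ}
    (hX : Integrable X (P : Measure E)) (h : ∀ ω, X ω ≤ Y ω) :
    ((∫ ω, X ω ∂(P : Measure E) : ℝ) : EReal) ≤ expect P Y := by
  have hle : ∫⁻ ω, ENNReal.ofReal (-Y ω) ∂(P : Measure E)
      ≤ ∫⁻ ω, ENNReal.ofReal (-X ω) ∂(P : Measure E) :=
    lintegral_mono fun ω => ENNReal.ofReal_le_ofReal (neg_le_neg (h ω))
  have hXlt : ∫⁻ ω, ENNReal.ofReal (-X ω) ∂(P : Measure E) < ⊤ := hX.neg.lintegral_lt_top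
  have hlt := lt_of_le_of_lt hle hXlt
  rw [← expect_of_integrable P hX, expect, expect, if_pos hlt, if_pos hXlt]
  refine EReal.sub_le_sub ?_ ?_
  · exact EReal.coe_ennreal_le_coe_ennreal_iff.2
      (lintegral_mono fun ω => ENNReal.ofReal_le_ofReal (h ω))
  · exact EReal.coe_ennreal_le_coe_ennreal_iff.2 hle

theorem expect_pos {P : ProbabilityMeasure E} {X : E → ℝ} (hX : Measurable X)
    (h : ∀ ω, 0 < X ω) : 0 < expect P X := by
  have h0 : ∫⁻ ω, ENNReal.ofReal (-X ω) ∂(P : Measure E) = 0 := by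
    have : ∀ ω, ENNReal.ofReal (-X ω) = 0 := fun ω =>
      ENNReal.ofReal_of_nonpos (neg_nonpos.2 (h ω).le)
    simp [this]
  rw [expect, if_pos (by rw [h0]; exact ENNReal.zero_lt_top), h0]
  simp only [EReal.coe_ennreal_zero, sub_zero, EReal.coe_ennreal_pos]
  rw [lintegral_pos_iff_support hX.ennreal_ofReal]
  have : Function.support (fun ω => ENNReal.ofReal (X ω)) = univ := by
    ext ω
    simp [h ω]
  rw [this]
  simp

end Expectation

section OneStep

variable {Ω ι : Type*} {m m0 : MeasurableSpace Ω} {μ : Measure Ω} {V W : Ω → ℝ}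

theorem lintegral_add_lintegral_neg_le (hV : Integrable V μ) (hW : Integrable W μ)
    (h : ∫ ω, W ω ∂μ ≤ ∫ ω, V ω ∂μ) :
    ∫⁻ ω, ENNReal.ofReal (W ω) ∂μ + ∫⁻ ω, ENNReal.ofReal (-V ω) ∂μ
      ≤ ∫⁻ ω, ENNReal.ofReal (V ω) ∂μ + ∫⁻ ω, ENNReal.ofReal (-W ω) ∂μ := by
  have hV₁ := hV.lintegral_lt_top.ne
  have hV₂ : ∫⁻ ω, ENNReal.ofReal (-V ω) ∂μ ≠ ⊤ := hV.neg.lintegral_lt_top.ne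
  have hW₁ := hW.lintegral_lt_top.ne
  have hW₂ : ∫⁻ ω, ENNReal.ofReal (-W ω) ∂μ ≠ ⊤ := hW.neg.lintegral_lt_top.ne
  rw [integral_eq_lintegral_pos_part_sub_lintegral_neg_part hV,
    integral_eq_lintegral_pos_part_sub_lintegral_neg_part hW] at h
  rw [← ENNReal.toReal_le_toReal (ENNReal.add_ne_top.2 ⟨hW₁, hV₂⟩)
    (ENNReal.add_ne_top.2 ⟨hV₁, hW₂⟩), ENNReal.toReal_add hW₁ hV₂, ENNReal.toReal_add hV₁ hW₂]
  linarith

theorem integrable_of_lintegral_ofReal_lt_top (hW : AEStronglyMeasurable W μ)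
    (hpos : ∫⁻ ω, ENNReal.ofReal (W ω) ∂μ < ⊤) (hneg : ∫⁻ ω, ENNReal.ofReal (-W ω) ∂μ < ⊤) :
    Integrable W μ := by
  refine ⟨hW, ?_⟩
  calc ∫⁻ ω, ‖W ω‖ₑ ∂μ
      ≤ ∫⁻ ω, (ENNReal.ofReal (W ω) + ENNReal.ofReal (-W ω)) ∂μ := by
        refine lintegral_mono fun ω => ?_
        rw [Real.enorm_eq_ofReal_abs]
        rcases abs_choice (W ω) with h | h <;> rw [h]
        exacts [le_self_add, le_add_self]
    _ = ∫⁻ ω, ENNReal.ofReal (W ω) ∂μ + ∫⁻ ω, ENNReal.ofReal (-W ω) ∂μ :=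
        lintegral_add_left' hW.aemeasurable.ennreal_ofReal _
    _ < ⊤ := ENNReal.add_lt_top.2 ⟨hpos, hneg⟩

section BoundedPosition

variable {D U : Ω → ℝ} {A : Set Ω} {c : ℝ}

theorem integrableOn_mul_of_bounded (hA : MeasurableSet A) (hD : Integrable D μ)
    (hU : Measurable U) (hU0 : ∀ ω, 0 ≤ U ω) (hUc : ∀ ω ∈ A, U ω ≤ c) :
    IntegrableOn (U * D) A μ :=
  hD.integrableOn.bdd_mul hU.aestronglyMeasurable <|
    (ae_restrict_iff' hA).2 <| Eventually.of_forall fun ω hω => by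
      simpa only [Real.norm_of_nonneg (hU0 ω)] using hUc ω hω

theorem setIntegral_mul_nonpos [IsFiniteMeasure μ] (hm : m ≤ m0) (hA : MeasurableSet[m] A)
    (hD : Integrable D μ) (hDm : μ[D | m] ≤ᵐ[μ] 0) (hU : Measurable[m] U) (hU0 : ∀ ω, 0 ≤ U ω)
    (hUc : ∀ ω ∈ A, U ω ≤ c) : ∫ ω in A, (U * D) ω ∂μ ≤ 0 := by
  have hmul : A.indicator (U * D) = A.indicator U * D := funext fun ω => indicator_mul_left A U D
  have hint : Integrable (A.indicator U * D) μ := by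
    rw [← hmul, integrable_indicator_iff (hm _ hA)]
    exact integrableOn_mul_of_bounded (hm _ hA) hD (hU.mono hm le_rfl) hU0 hUc
  calc ∫ ω in A, (U * D) ω ∂μ = ∫ ω, (A.indicator U * D) ω ∂μ := by
        rw [← integral_indicator (hm _ hA), hmul]
    _ = ∫ ω, (μ[A.indicator U * D | m]) ω ∂μ := (integral_condExp hm).symm
    _ = ∫ ω, (A.indicator U * μ[D | m]) ω ∂μ := integral_congr_ae <|
        condExp_mul_of_stronglyMeasurable_left (hU.indicator hA).stronglyMeasurable hint hD
    _ ≤ 0 := integral_nonpos_of_ae <| hDm.mono fun ω hω =>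
        mul_nonpos_of_nonneg_of_nonpos (indicator_nonneg (fun ω _ => hU0 ω) ω) hω

end BoundedPosition

variable [Fintype ι] {U D : ι → Ω → ℝ}

section

variable [IsFiniteMeasure μ] (hm : m ≤ m0) (hV : Measurable[m] V) (hU : ∀ i, Measurable[m] (U i))
  (hU0 : ∀ i ω, 0 ≤ U i ω) (hD : ∀ i, Integrable (D i) μ) (hDm : ∀ i, μ[D i | m] ≤ᵐ[μ] 0)
include hm hV hU hU0 hD hDm

theorem setLIntegral_add_gain_le_of_bounded {A : Set Ω} (hA : MeasurableSet[m] A) {c : ℝ}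
    (hc : ∀ ω ∈ A, |V ω| + ∑ i, |U i ω| ≤ c) :
    ∫⁻ ω in A, ENNReal.ofReal ((V + ∑ i, U i * D i) ω) ∂μ + ∫⁻ ω in A, ENNReal.ofReal (-V ω) ∂μ
      ≤ ∫⁻ ω in A, ENNReal.ofReal (V ω) ∂μ
        + ∫⁻ ω in A, ENNReal.ofReal (-(V + ∑ i, U i * D i) ω) ∂μ := by
  have hUc : ∀ i, ∀ ω ∈ A, U i ω ≤ c := fun i ω hω =>
    calc U i ω ≤ |U i ω| := le_abs_self _
      _ ≤ ∑ i, |U i ω| :=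
        Finset.single_le_sum (f := fun i => |U i ω|) (fun i _ => abs_nonneg _) (Finset.mem_univ i)
      _ ≤ |V ω| + ∑ i, |U i ω| := le_add_of_nonneg_left (abs_nonneg _)
      _ ≤ c := hc ω hω
  have hVi : IntegrableOn V A μ := by
    refine Measure.integrableOn_of_bounded (M := c) (measure_ne_top μ A)
      (hV.mono hm le_rfl).aestronglyMeasurable ((ae_restrict_iff' (hm _ hA)).2 ?_)
    exact Eventually.of_forall fun ω hω => (le_add_of_nonneg_right
      (Finset.sum_nonneg fun i _ => abs_nonneg _)).trans (hc ω hω)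
  have hUD : ∀ i, IntegrableOn (U i * D i) A μ := fun i =>
    integrableOn_mul_of_bounded (hm _ hA) (hD i) ((hU i).mono hm le_rfl) (hU0 i) (hUc i)
  have hsum : IntegrableOn (∑ i, U i * D i) A μ := integrable_finsetSum' _ fun i _ => hUD i
  refine lintegral_add_lintegral_neg_le hVi (hVi.add hsum) ?_
  rw [integral_add' hVi hsum]
  simp only [Finset.sum_apply]
  rw [integral_finsetSum _ fun i _ => hUD i]
  exact add_le_of_nonpos_right <| Finset.sum_nonpos fun i _ =>
    setIntegral_mul_nonpos hm hA (hD i) (hDm i) (hU i) (hU0 i) (hUc i)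

theorem setLIntegral_add_gain_le {B : Set Ω} (hB : MeasurableSet[m] B) :
    ∫⁻ ω in B, ENNReal.ofReal ((V + ∑ i, U i * D i) ω) ∂μ + ∫⁻ ω in B, ENNReal.ofReal (-V ω) ∂μ
      ≤ ∫⁻ ω in B, ENNReal.ofReal (V ω) ∂μ
        + ∫⁻ ω in B, ENNReal.ofReal (-(V + ∑ i, U i * D i) ω) ∂μ := by
  let A : ℕ → Set Ω := fun n => {ω | |V ω| + ∑ i, |U i ω| ≤ n}
  have hA : ∀ n, MeasurableSet[m] (A n) := fun n => measurableSet_le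
    ((measurable_norm.comp hV).add (Finset.measurable_fun_sum _ fun i _ =>
      measurable_norm.comp (hU i))) measurable_const
  have hcover : AECover (μ.restrict B) atTop A :=
    ⟨Eventually.of_forall fun ω =>
      (tendsto_natCast_atTop_atTop (R := ℝ)).eventually_ge_atTop (|V ω| + ∑ i, |U i ω|),
      fun n => hm _ (hA n)⟩
  have hlim : ∀ {f : Ω → ℝ}, AEMeasurable f μ →
      Tendsto (fun n => ∫⁻ ω in A n ∩ B, ENNReal.ofReal (f ω) ∂μ) atTop
        (𝓝 (∫⁻ ω in B, ENNReal.ofReal (f ω) ∂μ)) := fun hf => by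
    simpa only [Measure.restrict_restrict (hm _ (hA _))] using
      hcover.lintegral_tendsto_of_countably_generated hf.restrict.ennreal_ofReal
  have hVm : AEMeasurable V μ := (hV.mono hm le_rfl).aemeasurable
  have hWm : AEMeasurable (V + ∑ i, U i * D i) μ := hVm.add <|
    Finset.aemeasurable_sum _ fun i _ =>
      ((hU i).mono hm le_rfl).aemeasurable.mul (hD i).aemeasurable
  exact le_of_tendsto_of_tendsto' ((hlim hWm).add (hlim hVm.neg)) ((hlim hVm).add (hlim hWm.neg))
    fun n => setLIntegral_add_gain_le_of_bounded hm hV hU hU0 hD hDm ((hA n).inter hB)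
      fun ω hω => hω.1

theorem lintegral_neg_le_lintegral_neg_add_gain :
    ∫⁻ ω, ENNReal.ofReal (-V ω) ∂μ ≤ ∫⁻ ω, ENNReal.ofReal (-(V + ∑ i, U i * D i) ω) ∂μ := by
  have hB : MeasurableSet[m] {ω | V ω ≤ 0} := measurableSet_le hV measurable_const
  have hpos : ∫⁻ ω in {ω | V ω ≤ 0}, ENNReal.ofReal (V ω) ∂μ = 0 :=
    setLIntegral_eq_zero (hm _ hB) fun ω hω => ENNReal.ofReal_of_nonpos hω
  have hneg : ∫⁻ ω in {ω | V ω ≤ 0}, ENNReal.ofReal (-V ω) ∂μ = ∫⁻ ω, ENNReal.ofReal (-V ω) ∂μ :=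
    setLIntegral_eq_of_support_subset fun ω hω =>
      neg_nonneg.1 (ENNReal.ofReal_pos.1 (pos_iff_ne_zero.2 hω)).le
  calc ∫⁻ ω, ENNReal.ofReal (-V ω) ∂μ
      ≤ ∫⁻ ω in {ω | V ω ≤ 0}, ENNReal.ofReal (-(V + ∑ i, U i * D i) ω) ∂μ := by
        have h := le_add_self.trans (setLIntegral_add_gain_le hm hV hU hU0 hD hDm hB)
        rwa [hpos, hneg, zero_add] at h
    _ ≤ ∫⁻ ω, ENNReal.ofReal (-(V + ∑ i, U i * D i) ω) ∂μ := setLIntegral_le_lintegral _ _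

end

end OneStep

section SupermartingaleTransform

variable {Ω ι : Type*} [Fintype ι] {m0 : MeasurableSpace Ω} {μ : Measure Ω} [IsFiniteMeasure μ]
  {T : ℕ} {ℱ : Filtration (Fin (T + 1)) m0} {S : ι → Fin (T + 1) → Ω → ℝ} {ϑ : Fin T → ι → Ω → ℝ}

/-- The accumulated gain at time `t` of holding `ϑ k i` shares of asset `i`, with price process
`S i`, between times `k` and `k + 1`. -/
def tradingGain (S : ι → Fin (T + 1) → Ω → ℝ) (ϑ : Fin T → ι → Ω → ℝ) : Fin (T + 1) → Ω → ℝ :=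
  Fin.partialSum fun k => ∑ i, ϑ k i * (S i k.succ - S i k.castSucc)

theorem measurable_tradingGain (hS : ∀ i, StronglyAdapted ℱ (S i))
    (hϑ : ∀ k i, Measurable[ℱ k.castSucc] (ϑ k i)) (t : Fin (T + 1)) :
    Measurable[ℱ t] (tradingGain S ϑ t) := by
  induction t using Fin.induction with
  | zero =>
    rw [tradingGain, Fin.partialSum_zero]
    exact (measurable_const : Measurable[ℱ 0] fun _ => (0 : ℝ))
  | succ k ih =>
    have hk : ℱ k.castSucc ≤ ℱ k.succ := ℱ.mono Fin.castSucc_lt_succ.le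
    simp only [tradingGain, Fin.partialSum_succ]
    refine (ih.mono hk le_rfl).add ?_
    rw [Finset.sum_fn]
    exact Finset.measurable_fun_sum _ fun i _ => ((hϑ k i).mono hk le_rfl).mul <|
      (hS i k.succ).measurable.sub ((hS i k.castSucc).measurable.mono hk le_rfl)

theorem condExp_increment_nonpos {X : Fin (T + 1) → Ω → ℝ} (hX : Supermartingale X ℱ μ)
    (k : Fin T) : μ[X k.succ - X k.castSucc | ℱ k.castSucc] ≤ᵐ[μ] 0 := by
  filter_upwards [condExp_sub (hX.integrable k.succ) (hX.integrable k.castSucc) (ℱ k.castSucc),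
    hX.condExp_ae_le Fin.castSucc_lt_succ.le] with ω hsub hle
  rw [hsub, Pi.sub_apply, condExp_of_stronglyMeasurable (ℱ.le _) (hX.stronglyMeasurable _)
    (hX.integrable _)]
  exact sub_nonpos.2 hle

variable (hS : ∀ i, Supermartingale (S i) ℱ μ) (hϑ : ∀ k i, Measurable[ℱ k.castSucc] (ϑ k i))
  (hϑ0 : ∀ k i ω, 0 ≤ ϑ k i ω)
include hS hϑ hϑ0

theorem lintegral_tradingGain_le (t : Fin (T + 1))
    (hneg : ∫⁻ ω, ENNReal.ofReal (-tradingGain S ϑ t ω) ∂μ < ⊤) :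
    ∫⁻ ω, ENNReal.ofReal (tradingGain S ϑ t ω) ∂μ
      ≤ ∫⁻ ω, ENNReal.ofReal (-tradingGain S ϑ t ω) ∂μ := by
  induction t using Fin.induction with
  | zero => simp [tradingGain]
  | succ k ih =>
    have hV := measurable_tradingGain (fun i => (hS i).stronglyAdapted) hϑ k.castSucc
    have hD := fun i => ((hS i).integrable k.succ).sub ((hS i).integrable k.castSucc)
    have hDm := fun i => condExp_increment_nonpos (hS i) k
    have hsucc : tradingGain S ϑ k.succ = tradingGain S ϑ k.castSucc
        + ∑ i, ϑ k i * (S i k.succ - S i k.castSucc) := Fin.partialSum_succ _ k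
    rw [hsucc] at hneg ⊢
    have hVneg := (lintegral_neg_le_lintegral_neg_add_gain (ℱ.le _) hV (hϑ k) (hϑ0 k) hD
      hDm).trans_lt hneg
    have hstep := setLIntegral_add_gain_le (ℱ.le _) hV (hϑ k) (hϑ0 k) hD hDm .univ
    simp only [Measure.restrict_univ] at hstep
    refine (ENNReal.add_le_add_iff_right hVneg.ne).1 (hstep.trans ?_)
    rw [add_comm]
    exact add_le_add_right (ih hVneg) _

theorem integrable_tradingGain (t : Fin (T + 1))
    (hneg : ∫⁻ ω, ENNReal.ofReal (-tradingGain S ϑ t ω) ∂μ < ⊤) :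
    Integrable (tradingGain S ϑ t) μ :=
  integrable_of_lintegral_ofReal_lt_top
    ((measurable_tradingGain (fun i => (hS i).stronglyAdapted) hϑ t).mono (ℱ.le t)
      le_rfl).aestronglyMeasurable
    ((lintegral_tradingGain_le hS hϑ hϑ0 t hneg).trans_lt hneg) hneg

theorem integral_tradingGain_nonpos (t : Fin (T + 1))
    (hneg : ∫⁻ ω, ENNReal.ofReal (-tradingGain S ϑ t ω) ∂μ < ⊤) :
    ∫ ω, tradingGain S ϑ t ω ∂μ ≤ 0 := by
  rw [integral_eq_lintegral_pos_part_sub_lintegral_neg_part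
    (integrable_tradingGain hS hϑ hϑ0 t hneg)]
  exact sub_nonpos.2 <| ENNReal.toReal_mono hneg.ne (lintegral_tradingGain_le hS hϑ hϑ0 t hneg)

end SupermartingaleTransform

section ContinuousTestFunctions

variable {Ω X : Type*} {m0 : MeasurableSpace Ω} {μ : Measure Ω} [TopologicalSpace X]
  [MeasurableSpace X] [BorelSpace X]

theorem measure_le_of_forall_lintegral_le [HasOuterApproxClosed X] {ν₁ ν₂ : Measure X}
    [IsFiniteMeasure ν₁] [IsFiniteMeasure ν₂] [ν₁.WeaklyRegular]
    (h : ∀ φ : BoundedContinuousFunction X NNReal, ∫⁻ x, φ x ∂ν₁ ≤ ∫⁻ x, φ x ∂ν₂)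
    {A : Set X} (hA : MeasurableSet A) : ν₁ A ≤ ν₂ A := by
  rw [hA.measure_eq_iSup_isClosed_of_ne_top (measure_ne_top ν₁ A)]
  refine iSup_le fun F => iSup_le fun hFA => iSup_le fun hF => ?_
  refine le_trans ?_ (measure_mono hFA)
  exact le_of_tendsto_of_tendsto' (HasOuterApproxClosed.tendsto_lintegral_apprSeq hF ν₁)
    (HasOuterApproxClosed.tendsto_lintegral_apprSeq hF ν₂) fun n => h _

theorem lintegral_ofReal_le_iff_integral_nonpos {D : Ω → ℝ} (hD : Integrable D μ) :
    ∫⁻ ω, ENNReal.ofReal (D ω) ∂μ ≤ ∫⁻ ω, ENNReal.ofReal (-D ω) ∂μ ↔ ∫ ω, D ω ∂μ ≤ 0 := by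
  have hneg : ∫⁻ ω, ENNReal.ofReal (-D ω) ∂μ ≠ ⊤ := hD.neg.lintegral_lt_top.ne
  rw [integral_eq_lintegral_pos_part_sub_lintegral_neg_part hD, sub_nonpos,
    ENNReal.toReal_le_toReal hD.lintegral_lt_top.ne hneg]

theorem integrable_boundedContinuous_comp_mul {D : Ω → ℝ} (hD : Integrable D μ) {π : Ω → X}
    (hπ : Measurable π) (φ : BoundedContinuousFunction X NNReal) :
    Integrable (fun ω => (φ (π ω) : ℝ) * D ω) μ :=
  hD.bdd_mul (c := nndist φ 0)
    (φ.continuous.measurable.comp hπ).coe_nnreal_real.aestronglyMeasurable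
    (Eventually.of_forall fun ω => by
      rw [Real.norm_of_nonneg (φ (π ω)).coe_nonneg]
      exact NNReal.coe_le_coe.2 (BoundedContinuousFunction.NNReal.upper_bound φ (π ω)))

theorem setIntegral_preimage_nonpos_of_forall_continuous [TopologicalSpace.PseudoMetrizableSpace X]
    {D : Ω → ℝ} (hD : Integrable D μ) {π : Ω → X} (hπ : Measurable π)
    (h : ∀ φ : BoundedContinuousFunction X NNReal, ∫ ω, φ (π ω) * D ω ∂μ ≤ 0) {B : Set X}
    (hB : MeasurableSet B) : ∫ ω in π ⁻¹' B, D ω ∂μ ≤ 0 := by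
  let ν : (Ω → ℝ) → Measure X := fun f => (μ.withDensity fun ω => ENNReal.ofReal (f ω)).map π
  have hfin : ∀ {f : Ω → ℝ}, Integrable f μ → IsFiniteMeasure (ν f) := fun hf =>
    have := isFiniteMeasure_withDensity (μ := μ) hf.lintegral_lt_top.ne
    inferInstance
  have hval : ∀ {f : Ω → ℝ}, AEMeasurable f μ → ∀ φ : BoundedContinuousFunction X NNReal,
      ∫⁻ x, φ x ∂ν f = ∫⁻ ω, ENNReal.ofReal (φ (π ω) * f ω) ∂μ := fun hf φ => by
    have hφ : Measurable fun x => (φ x : ENNReal) := φ.continuous.measurable.coe_nnreal_ennreal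
    have hφπ : AEMeasurable (fun ω => (φ (π ω) : ENNReal)) μ := (hφ.comp hπ).aemeasurable
    rw [lintegral_map hφ hπ, lintegral_withDensity_eq_lintegral_mul₀ hf.ennreal_ofReal hφπ]
    refine lintegral_congr fun ω => ?_
    rw [ENNReal.ofReal_mul NNReal.zero_le_coe, ENNReal.ofReal_coe_nnreal, mul_comm]
    rfl
  have hνB : ∀ f : Ω → ℝ, ν f B = ∫⁻ ω in π ⁻¹' B, ENNReal.ofReal (f ω) ∂μ := fun f => by
    rw [Measure.map_apply hπ hB, withDensity_apply _ (hπ hB)]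
  have := hfin hD
  have := hfin hD.neg
  have hle : ν D B ≤ ν (-D) B := measure_le_of_forall_lintegral_le (fun φ => by
    have hφD := integrable_boundedContinuous_comp_mul hD hπ φ
    rw [hval hD.aemeasurable, hval hD.neg.aemeasurable]
    simpa only [Pi.neg_apply, mul_neg] using
      (lintegral_ofReal_le_iff_integral_nonpos hφD).2 (h φ)) hB
  rw [hνB, hνB] at hle
  exact (lintegral_ofReal_le_iff_integral_nonpos hD.integrableOn).1 hle

variable [IsFiniteMeasure μ] {T : ℕ} {S : Fin (T + 1) → Ω → ℝ}

theorem supermartingale_of_setIntegral_succ_le_fin {ℱ : Filtration (Fin (T + 1)) m0}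
    (hadp : StronglyAdapted ℱ S) (hint : ∀ t, Integrable (S t) μ)
    (h : ∀ k : Fin T, ∀ A, MeasurableSet[ℱ k.castSucc] A →
      ∫ ω in A, S k.succ ω ∂μ ≤ ∫ ω in A, S k.castSucc ω ∂μ) :
    Supermartingale S ℱ μ := by
  have hchain : ∀ s t, s ≤ t → ∀ A, MeasurableSet[ℱ s] A →
      ∫ ω in A, S t ω ∂μ ≤ ∫ ω in A, S s ω ∂μ := fun s t => by
    induction t using Fin.induction with
    | zero => exact fun hs A _ => Fin.le_zero_iff.1 hs ▸ le_rfl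
    | succ k ih =>
      intro hs A hA
      rcases hs.eq_or_lt with rfl | hlt
      · exact le_rfl
      · have hsk : s ≤ k.castSucc := Fin.le_castSucc_iff.2 hlt
        exact (h k A (ℱ.mono hsk _ hA)).trans (ih hsk A hA)
  have hneg : Submartingale (-S) ℱ μ :=
    submartingale_of_setIntegral_le hadp.neg (fun t => (hint t).neg) fun s t hst A hA => by
      simpa only [Pi.neg_apply, integral_neg, neg_le_neg_iff] using hchain s t hst A hA
  simpa only [neg_neg] using hneg.neg

theorem supermartingale_natural_of_forall_continuous {β : Type*} [TopologicalSpace β]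
    [TopologicalSpace.MetrizableSpace β] [SecondCountableTopology β] [MeasurableSpace β]
    [BorelSpace β] {Y : Fin (T + 1) → Ω → β} (hY : ∀ t, StronglyMeasurable (Y t))
    (hadp : StronglyAdapted (Filtration.natural Y hY) S) (hint : ∀ t, Integrable (S t) μ)
    (h : ∀ (k : Fin T) (φ : BoundedContinuousFunction (Iic k.castSucc → β) NNReal),
      ∫ ω, φ (fun s => Y s ω) * (S k.succ ω - S k.castSucc ω) ∂μ ≤ 0) :
    Supermartingale S (Filtration.natural Y hY) μ := by
  refine supermartingale_of_setIntegral_succ_le_fin hadp hint fun k A hA => ?_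
  rw [Filtration.natural_eq_comap] at hA
  obtain ⟨B, hB, rfl⟩ := hA
  have hπ : Measurable fun ω (s : Iic k.castSucc) => Y s ω :=
    measurable_pi_lambda _ fun s => (hY s).measurable
  have hle := setIntegral_preimage_nonpos_of_forall_continuous
    ((hint k.succ).sub (hint k.castSucc)) hπ (h k) hB
  rwa [integral_sub' (hint _).integrableOn (hint _).integrableOn, sub_nonpos] at hle

end ContinuousTestFunctions

section PriceModel

variable {J T : ℕ} {Ω : Set (Fin T → Fin (J + 1) → ℝ)} {a b : Fin T → ℝ} {s₀ : Fin J → ℝ} {p : ℝ}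

/-- The standing assumptions on the scenarios and the initial prices: the numeraire stays between
positive bounds `a` and `b`, and the risky prices are non-negative. -/
structure IsPriceModel (Ω : Set (Fin T → Fin (J + 1) → ℝ)) (a b : Fin T → ℝ) (s₀ : Fin J → ℝ) :
    Prop where
  closed : IsClosed Ω
  pos : ∀ k, 0 < a k
  bounds : ∀ ω ∈ Ω, ∀ k, ω k 0 ∈ Icc (a k) (b k) ∧ ∀ j : Fin J, 0 ≤ ω k j.succ
  init : ∀ j, 0 ≤ s₀ j

theorem continuous_price (s₀ : Fin J → ℝ) (t : Fin (T + 1)) (j : Fin (J + 1)) :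
    Continuous (price s₀ t j : Ω → ℝ) := by
  cases t using Fin.cases with
  | zero => exact continuous_const
  | succ k => exact (continuous_apply_apply k j).comp continuous_subtype_val

theorem discPrice_zero (s₀ : Fin J → ℝ) (j : Fin J) (ω : Ω) : discPrice s₀ 0 j ω = s₀ j := by
  simp [discPrice, price]

theorem stronglyAdapted_discPrice (s₀ : Fin J → ℝ) (j : Fin J) :
    StronglyAdapted (priceFiltration Ω s₀) fun t => discPrice s₀ t j := fun t => by
  have hprice := (Filtration.stronglyAdapted_natural
    (stronglyMeasurable_price (Ω := Ω) s₀) t).measurable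
  exact (((measurable_pi_apply j.succ).comp hprice).div
    ((measurable_pi_apply 0).comp hprice)).stronglyMeasurable

theorem measurable_discPrice (s₀ : Fin J → ℝ) (t : Fin (T + 1)) (j : Fin J) :
    Measurable (discPrice s₀ t j : Ω → ℝ) :=
  (stronglyAdapted_discPrice s₀ j t).measurable.mono ((priceFiltration Ω s₀).le t) le_rfl

namespace IsPriceModel

variable (M : IsPriceModel Ω a b s₀)
include M

theorem price_zero_pos (t : Fin (T + 1)) (ω : Ω) : 0 < price s₀ t 0 ω := by
  cases t using Fin.cases with
  | zero => exact one_pos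
  | succ k => exact (M.pos k).trans_le (M.bounds ω ω.2 k).1.1

theorem discPrice_nonneg (t : Fin (T + 1)) (j : Fin J) (ω : Ω) : 0 ≤ discPrice s₀ t j ω := by
  cases t using Fin.cases with
  | zero => exact discPrice_zero s₀ j ω ▸ M.init j
  | succ k => exact div_nonneg ((M.bounds ω ω.2 k).2 j) (M.price_zero_pos _ ω).le

theorem continuous_discPrice (t : Fin (T + 1)) (j : Fin J) :
    Continuous (discPrice s₀ t j : Ω → ℝ) :=
  (continuous_price s₀ t j.succ).div (continuous_price s₀ t 0) fun ω => (M.price_zero_pos t ω).ne'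

theorem discPrice_rpow_nonneg (p : ℝ) (t : Fin (T + 1)) (j : Fin J) (ω : Ω) :
    0 ≤ discPrice s₀ t j ω ^ p :=
  Real.rpow_nonneg (M.discPrice_nonneg t j ω) p

theorem one_le_growth (p : ℝ) : 1 ≤ (growth s₀ p : Ω → ℝ) := fun ω =>
  le_add_of_nonneg_right <| Finset.sum_nonneg fun k _ => Finset.sum_nonneg fun j _ =>
    M.discPrice_rpow_nonneg p k.succ j ω

theorem growth_pos (p : ℝ) (ω : Ω) : 0 < growth s₀ p ω := one_pos.trans_le (M.one_le_growth p ω)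

theorem continuous_growth (hp : 0 ≤ p) : Continuous (growth s₀ p : Ω → ℝ) :=
  continuous_const.add <| continuous_finsetSum _ fun _ _ => continuous_finsetSum _ fun _ _ =>
    (M.continuous_discPrice _ _).rpow_const fun _ => Or.inr hp

theorem discPrice_rpow_le_growth (p : ℝ) (k : Fin T) (j : Fin J) (ω : Ω) :
    discPrice s₀ k.succ j ω ^ p ≤ growth s₀ p ω :=
  calc discPrice s₀ k.succ j ω ^ p
      ≤ ∑ i, discPrice s₀ k.succ i ω ^ p := Finset.single_le_sum
        (fun i _ => M.discPrice_rpow_nonneg p k.succ i ω) (Finset.mem_univ j)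
    _ ≤ ∑ l : Fin T, ∑ i, discPrice s₀ l.succ i ω ^ p := Finset.single_le_sum
        (f := fun l : Fin T => ∑ i, discPrice s₀ l.succ i ω ^ p)
        (fun l _ => Finset.sum_nonneg fun i _ => M.discPrice_rpow_nonneg p l.succ i ω)
        (Finset.mem_univ k)
    _ ≤ growth s₀ p ω := le_add_of_nonneg_left zero_le_one

theorem discPrice_succ_le_growth (hp : 1 ≤ p) (k : Fin T) (j : Fin J) (ω : Ω) :
    discPrice s₀ k.succ j ω ≤ growth s₀ p ω := by
  rcases le_total (discPrice s₀ k.succ j ω) 1 with h | h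
  · exact h.trans (M.one_le_growth p ω)
  · exact (Real.self_le_rpow_of_one_le h hp).trans (M.discPrice_rpow_le_growth p k j ω)

theorem discPrice_mem_dominatedBy (hp : 1 ≤ p) (t : Fin (T + 1)) (j : Fin J) :
    (discPrice s₀ t j : Ω → ℝ) ∈ dominatedBy (growth s₀ p : Ω → ℝ) := by
  cases t using Fin.cases with
  | zero =>
    refine mem_dominatedBy_of_abs_le_abs
      (Submodule.smul_mem _ (s₀ j) (one_mem_dominatedBy (M.one_le_growth p))) fun ω => ?_
    simp [discPrice_zero]
  | succ k =>
    exact mem_dominatedBy_of_abs_le_abs self_mem_dominatedBy fun ω =>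
      abs_le_abs_of_nonneg (M.discPrice_nonneg _ j ω) (M.discPrice_succ_le_growth hp k j ω)

theorem isCompact_growth_le (hp : 1 ≤ p) (R : ℝ) : IsCompact {ω : Ω | growth s₀ p ω ≤ R} := by
  have hbox : IsCompact ((↑) ⁻¹' Icc (0 : Fin T → Fin (J + 1) → ℝ) (fun k _ => max R 1 * b k) :
      Set Ω) := M.closed.isClosedEmbedding_subtypeVal.isCompact_preimage isCompact_Icc
  refine hbox.of_isClosed_subset (isClosed_le (M.continuous_growth (zero_le_one.trans hp))
    continuous_const) fun ω (hω : growth s₀ p ω ≤ R) => ?_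
  have hnum : ∀ k, 0 ≤ ω.1 k 0 ∧ ω.1 k 0 ≤ b k := fun k =>
    ⟨(M.pos k).le.trans (M.bounds ω ω.2 k).1.1, (M.bounds ω ω.2 k).1.2⟩
  have hcoord : ∀ k j, 0 ≤ ω.1 k j ∧ ω.1 k j ≤ max R 1 * b k := fun k j => by
    cases j using Fin.cases with
    | zero => exact ⟨(hnum k).1, (hnum k).2.trans <|
        le_mul_of_one_le_left ((hnum k).1.trans (hnum k).2) (le_max_right _ _)⟩
    | succ j =>
      have hdisc : discPrice s₀ k.succ j ω ≤ max R 1 :=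
        (M.discPrice_succ_le_growth hp k j ω).trans (hω.trans (le_max_left R 1))
      exact ⟨(M.bounds ω ω.2 k).2 j, ((div_le_iff₀ (M.price_zero_pos k.succ ω)).1 hdisc).trans <|
        mul_le_mul_of_nonneg_left (hnum k).2 (zero_le_one.trans (le_max_right _ _))⟩
  exact ⟨fun k j => (hcoord k j).1, fun k j => (hcoord k j).2⟩

theorem locallyCompactSpace : LocallyCompactSpace Ω :=
  M.closed.isClosedEmbedding_subtypeVal.locallyCompactSpace

end IsPriceModel

end PriceModel

section DynamicTrading

variable {J T : ℕ} {Ω : Set (Fin T → Fin (J + 1) → ℝ)} {s₀ : Fin J → ℝ}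
  {ϑ : Fin T → Fin J → Ω → ℝ}

theorem dynGain_eq_tradingGain (s₀ : Fin J → ℝ) (ϑ : Fin T → Fin J → Ω → ℝ) :
    dynGain s₀ ϑ = tradingGain (fun j t => discPrice s₀ t j) ϑ (Fin.last T) := by
  rw [tradingGain, Fin.partialSum, Fin.val_last, List.take_of_length_le (by simp), List.sum_ofFn]
  ext ω
  simp [dynGain]

theorem measurable_dynGain (hϑ : IsLongStrategy s₀ ϑ) : Measurable (dynGain s₀ ϑ) := by
  rw [dynGain_eq_tradingGain]
  exact (measurable_tradingGain (stronglyAdapted_discPrice s₀) (fun k j => (hϑ k j).1) _).mono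
    ((priceFiltration Ω s₀).le _) le_rfl

theorem isLongStrategy_single {k : Fin T} (j : Fin J) {u : Ω → ℝ}
    (hu : Measurable[priceFiltration Ω s₀ k.castSucc] u) (hu0 : 0 ≤ u) :
    IsLongStrategy s₀ (Pi.single k (Pi.single j u)) := by
  intro k' j'
  rcases eq_or_ne k' k with rfl | hk
  · rcases eq_or_ne j' j with rfl | hj
    · simp only [Pi.single_eq_same]
      exact ⟨hu, hu0⟩
    · simp [Pi.single_eq_of_ne hj, measurable_zero]
  · simp [Pi.single_eq_of_ne hk, measurable_zero]

theorem dynGain_single (s₀ : Fin J → ℝ) (k : Fin T) (j : Fin J) (u : Ω → ℝ) :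
    dynGain s₀ (Pi.single k (Pi.single j u))
      = u * (discPrice s₀ k.succ j - discPrice s₀ k.castSucc j) := by
  ext ω
  rw [dynGain, Finset.sum_eq_single k (fun k' _ hk => by simp [hk]) (by simp),
    Finset.sum_eq_single j (fun j' _ hj => by simp [hj]) (by simp)]
  simp

theorem IsSupermartingaleMeasure.expect_dynGain_add_le {P : ProbabilityMeasure Ω}
    (hP : IsSupermartingaleMeasure s₀ P) (hϑ : IsLongStrategy s₀ ϑ) {Y : Ω → ℝ}
    (hY : Integrable Y (P : Measure Ω)) :
    expect P (dynGain s₀ ϑ + Y) ≤ expect P Y := by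
  by_cases hneg : ∫⁻ ω, ENNReal.ofReal (-(dynGain s₀ ϑ + Y) ω) ∂(P : Measure Ω) < ⊤
  · have hdyn : ∫⁻ ω, ENNReal.ofReal (-dynGain s₀ ϑ ω) ∂(P : Measure Ω) < ⊤ :=
      calc ∫⁻ ω, ENNReal.ofReal (-dynGain s₀ ϑ ω) ∂(P : Measure Ω)
          ≤ ∫⁻ ω, (ENNReal.ofReal (-(dynGain s₀ ϑ + Y) ω) + ENNReal.ofReal (Y ω))
              ∂(P : Measure Ω) := lintegral_mono fun ω => by
            rw [show -dynGain s₀ ϑ ω = -(dynGain s₀ ϑ + Y) ω + Y ω by simp]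
            exact ENNReal.ofReal_add_le
        _ = _ := lintegral_add_right' _ hY.aemeasurable.ennreal_ofReal
        _ < ⊤ := ENNReal.add_lt_top.2 ⟨hneg, hY.lintegral_lt_top⟩
    rw [dynGain_eq_tradingGain] at hdyn ⊢
    have hpred := fun k j => (hϑ k j).1
    have hnonneg := fun k j => (hϑ k j).2
    have hint : Integrable (tradingGain (fun j t => discPrice s₀ t j) ϑ _) (P : Measure Ω) :=
      integrable_tradingGain hP hpred hnonneg _ hdyn
    have hgain := integral_tradingGain_nonpos hP hpred hnonneg _ hdyn
    rw [expect_of_integrable P (hint.add hY), expect_of_integrable P hY, EReal.coe_le_coe_iff,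
      integral_add' hint hY]
    exact add_le_of_nonpos_left hgain
  · exact expect_eq_bot hneg ▸ bot_le

namespace IsPriceModel

variable {a b : Fin T → ℝ} {p : ℝ} (M : IsPriceModel Ω a b s₀) (hp : 1 ≤ p)
  {P : ProbabilityMeasure Ω} {C : ℝ}
  (hC : ∀ ϑ : Fin T → Fin J → Ω → ℝ, IsLongStrategy s₀ ϑ → Continuous (dynGain s₀ ϑ) →
    dynGain s₀ ϑ ∈ dominatedBy (growth s₀ p : Ω → ℝ) → ∫ ω, dynGain s₀ ϑ ω ∂(P : Measure Ω) ≤ C)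
include M hp hC

theorem integral_mul_increment_nonpos {k : Fin T} (j : Fin J) {u : Ω → ℝ}
    (hu : Measurable[priceFiltration Ω s₀ k.castSucc] u) (hu0 : 0 ≤ u) (huc : Continuous u)
    {c : ℝ} (hub : ∀ ω, u ω ≤ c) :
    ∫ ω, u ω * (discPrice s₀ k.succ j ω - discPrice s₀ k.castSucc j ω) ∂(P : Measure Ω) ≤ 0 := by
  set D : Ω → ℝ := discPrice s₀ k.succ j - discPrice s₀ k.castSucc j
  have hgain : ∀ n : ℕ, dynGain s₀ (Pi.single k (Pi.single j ((n : ℝ) • u))) = (n : ℝ) • (u * D) :=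
    fun n => by rw [dynGain_single, smul_mul_assoc]
  have hcont : Continuous (u * D) :=
    huc.mul ((M.continuous_discPrice _ j).sub (M.continuous_discPrice _ j))
  have hdom : u * D ∈ dominatedBy (growth s₀ p : Ω → ℝ) :=
    mul_mem_dominatedBy (fun ω => (abs_of_nonneg (hu0 ω)).trans_le (hub ω))
      (sub_mem (M.discPrice_mem_dominatedBy hp _ j) (M.discPrice_mem_dominatedBy hp _ j))
  have hscale : ∀ n : ℕ, n * ∫ ω, (u * D) ω ∂(P : Measure Ω) ≤ C := fun n => by
    have hle := hC _ (isLongStrategy_single j (hu.const_smul (n : ℝ))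
      (smul_nonneg n.cast_nonneg hu0))
    simp only [hgain, Pi.smul_apply, smul_eq_mul, integral_const_mul] at hle
    exact hle (hcont.const_smul _) (Submodule.smul_mem _ _ hdom)
  by_contra! hpos
  obtain ⟨n, hn⟩ := exists_nat_gt (C / ∫ ω, (u * D) ω ∂(P : Measure Ω))
  exact absurd (hscale n) (not_le.2 ((div_lt_iff₀ hpos).1 hn))

theorem isSupermartingaleMeasure (hZ : Integrable (growth s₀ p) (P : Measure Ω)) :
    IsSupermartingaleMeasure s₀ P := fun j => by
  have hint : ∀ t, Integrable (discPrice s₀ t j) (P : Measure Ω) := fun t =>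
    integrable_of_mem_dominatedBy hZ (M.discPrice_mem_dominatedBy hp t j)
      (measurable_discPrice s₀ t j)
  refine supermartingale_natural_of_forall_continuous (stronglyMeasurable_price s₀)
    (stronglyAdapted_discPrice s₀ j) hint fun k φ => ?_
  let history : Ω → Iic k.castSucc → Fin (J + 1) → ℝ := fun ω s i => price s₀ s i ω
  have hhistory : Measurable[priceFiltration Ω s₀ k.castSucc] history := by
    rw [priceFiltration, Filtration.natural_eq_comap]
    exact comap_measurable _
  have hhistoryc : Continuous history :=
    continuous_pi fun s => continuous_pi fun i => continuous_price s₀ s.1 i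
  have hφ : Continuous fun x => (φ x : ℝ) := NNReal.continuous_coe.comp φ.continuous
  exact M.integral_mul_increment_nonpos hp hC j (hφ.measurable.comp hhistory)
    (fun _ => NNReal.coe_nonneg _) (hφ.comp hhistoryc)
    fun ω => NNReal.coe_le_coe.2 (BoundedContinuousFunction.NNReal.upper_bound φ (history ω))

end IsPriceModel

end DynamicTrading

section Superhedging

variable {E : Type*} [MeasurableSpace E] {Z : E → ℝ} {G : Set (E → ℝ)} {P : ProbabilityMeasure E}
  {X : E → ℝ}

theorem mem_dominatedBy_of_mem_boundedBy (hZ : ∀ ω, 0 < Z ω) (hX : X ∈ boundedBy Z) :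
    X ∈ dominatedBy Z := by
  obtain ⟨-, C, hC⟩ := hX
  refine mem_dominatedBy_of_abs_le (C := C) fun ω => ?_
  simpa only [abs_div, div_le_iff₀ (abs_pos.2 (hZ ω).ne')] using hC ω

theorem zero_mem_uscBoundedBy [TopologicalSpace E] (Z : E → ℝ) : 0 ∈ uscBoundedBy Z :=
  ⟨⟨measurable_const, 0, fun ω => by simp⟩, continuous_const.upperSemicontinuous⟩

theorem expect_zero (P : ProbabilityMeasure E) : expect P (0 : E → ℝ) = 0 := by
  simp [expect]

theorem expect_le_penalty (P : ProbabilityMeasure E) (hX : X ∈ G) : expect P X ≤ penalty G P :=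
  le_iSup₂ (f := fun X (_ : X ∈ G) => expect P X) X hX

theorem superhedge_eq_sInf (hG : ∀ g ∈ G, Measurable g) (hX : Measurable X) :
    superhedge (posCone E) G X = sInf ((fun m : ℝ => (m : EReal)) '' hedgeCapital G X) := by
  unfold superhedge
  congr 2
  ext m
  rw [mem_hedgeCapital]
  constructor
  · rintro ⟨Y, hY, g, hg, hYg⟩
    refine ⟨g, hg, fun ω => ?_⟩
    have hω : Y ω - g ω = m - X ω := congrFun hYg ω
    linarith [hY.2 ω]
  · rintro ⟨g, hg, hle⟩
    exact ⟨fun ω => m - X ω + g ω, ⟨(measurable_const.sub hX).add (hG g hg),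
      fun ω => by linarith [hle ω]⟩, g, hg, by ext ω; simp⟩

theorem IsHedgingSet.superhedge_eq (hG : IsHedgingSet Z G) (hm : ∀ g ∈ G, Measurable g)
    (hX : Measurable X) (hXZ : X ∈ dominatedBy Z) :
    superhedge (posCone E) G X = (hedgeCost G X : EReal) := by
  rw [superhedge_eq_sInf hm hX, hedgeCost]
  exact (EReal.coe_strictMono.monotone.map_csInf_of_continuousAt
    continuous_coe_real_ereal.continuousAt (hG.hedgeCapital_nonempty hXZ)
    (hG.hedgeCapital_bddBelow hXZ)).symm

theorem IsHedgingSet.superhedge_zero (hG : IsHedgingSet Z G) (hm : ∀ g ∈ G, Measurable g) :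
    superhedge (posCone E) G 0 = 0 := by
  rw [hG.superhedge_eq hm measurable_zero (Submodule.zero_mem _), hG.cost_zero, EReal.coe_zero]

theorem expect_sub_penalty_le_superhedge (hm : ∀ g ∈ G, Measurable g) (hX : Measurable X)
    (hXi : Integrable X (P : Measure E)) :
    expect P X - penalty G P ≤ superhedge (posCone E) G X := by
  rw [superhedge_eq_sInf hm hX]
  refine le_sInf ?_
  rintro _ ⟨m, hcap, rfl⟩
  obtain ⟨g, hg, hle⟩ := mem_hedgeCapital.1 hcap
  have hpen : ((∫ ω, (X ω - m) ∂(P : Measure E) : ℝ) : EReal) ≤ penalty G P :=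
    (expect_mono_of_integrable (hXi.sub (integrable_const m)) fun ω =>
      sub_le_iff_le_add'.2 (hle ω)).trans (expect_le_penalty P hg)
  calc expect P X - penalty G P
      ≤ ((∫ ω, X ω ∂(P : Measure E) : ℝ) : EReal) - (∫ ω, (X ω - m) ∂(P : Measure E) : ℝ) :=
        EReal.sub_le_sub (expect_of_integrable P hXi).le hpen
    _ = m := by
        rw [← EReal.coe_sub, integral_sub hXi (integrable_const m)]
        simp

theorem genMartMeasures_nonempty_of_isGreatest
    (h : IsGreatest ((fun P => expect P 0 - penalty G P) '' probInt Z) 0) :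
    (genMartMeasures Z G).Nonempty := by
  obtain ⟨P, hP, hPeq⟩ := h.1
  refine ⟨P, hP, ?_⟩
  simpa only [expect_zero, zero_sub, EReal.neg_eq_zero_iff] using hPeq

theorem not_exists_pos_of_mem_genMartMeasures (hm : ∀ g ∈ G, Measurable g)
    (hP : P ∈ genMartMeasures Z G) : ¬ ∃ X ∈ G, ∀ ω, 0 < X ω := by
  rintro ⟨X, hX, hpos⟩
  exact ((expect_pos (hm X hX) hpos).trans_le (expect_le_penalty P hX)).ne' hP.2

end Superhedging

section DerivativeMarket

variable {J T : ℕ} {Ω : Set (Fin T → Fin (J + 1) → ℝ)} {I : Type*} {Z : Ω → ℝ} {H : I → Ω → ℝ}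
  {Θ : Set (I →₀ ℝ)} {h : (I →₀ ℝ) → Ω → ℝ} {s₀ : Fin J → ℝ}

/-- The standing assumptions on the payoffs `H` of the derivatives, the admissible static positions
`Θ` and their costs `h`. -/
structure IsDerivativeMarket (Z : Ω → ℝ) (H : I → Ω → ℝ) (Θ : Set (I →₀ ℝ))
    (h : (I →₀ ℝ) → Ω → ℝ) : Prop where
  payoff_mem : ∀ i, H i ∈ contBoundedBy Z
  zero_mem : 0 ∈ Θ
  cost_mem : ∀ θ ∈ Θ, h θ ∈ contBoundedBy Z
  cost_convex : ConvexOn ℝ Θ h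
  cost_zero : h 0 = 0

theorem staticGain_eq (H : I → Ω → ℝ) (h : (I →₀ ℝ) → Ω → ℝ) (θ : I →₀ ℝ) :
    staticGain H h θ = Finsupp.linearCombination ℝ H θ - h θ := by
  ext ω
  simp [staticGain, Finsupp.linearCombination_apply, Finsupp.sum]

theorem concaveOn_staticGain (hh : ConvexOn ℝ Θ h) : ConcaveOn ℝ Θ (staticGain H h) := by
  rw [show staticGain H h = ⇑(Finsupp.linearCombination ℝ H) - h from funext (staticGain_eq H h)]
  exact ((Finsupp.linearCombination ℝ H).concaveOn hh.1).sub hh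

theorem isLongStrategy_zero (s₀ : Fin J → ℝ) :
    IsLongStrategy s₀ (0 : Fin T → Fin J → Ω → ℝ) :=
  fun _ _ => ⟨measurable_const, fun _ => le_rfl⟩

theorem dynGain_zero (s₀ : Fin J → ℝ) : dynGain s₀ (0 : Fin T → Fin J → Ω → ℝ) = 0 := by
  ext ω
  simp [dynGain]

theorem IsLongStrategy.combo {ϑ₁ ϑ₂ : Fin T → Fin J → Ω → ℝ} (h₁ : IsLongStrategy s₀ ϑ₁)
    (h₂ : IsLongStrategy s₀ ϑ₂) {a b : ℝ} (ha : 0 ≤ a) (hb : 0 ≤ b) :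
    IsLongStrategy s₀ (a • ϑ₁ + b • ϑ₂) := fun k j =>
  ⟨((h₁ k j).1.const_smul a).add ((h₂ k j).1.const_smul b), fun ω =>
    add_nonneg (mul_nonneg ha ((h₁ k j).2 ω)) (mul_nonneg hb ((h₂ k j).2 ω))⟩

theorem dynGain_combo (s₀ : Fin J → ℝ) (ϑ₁ ϑ₂ : Fin T → Fin J → Ω → ℝ) (a b : ℝ) :
    dynGain s₀ (a • ϑ₁ + b • ϑ₂) = a • dynGain s₀ ϑ₁ + b • dynGain s₀ ϑ₂ := by
  ext ω
  simp only [dynGain, Pi.add_apply, Pi.smul_apply, smul_eq_mul, Finset.mul_sum,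
    ← Finset.sum_add_distrib]
  exact Finset.sum_congr rfl fun k _ => Finset.sum_congr rfl fun j _ => by ring

theorem convex_lowerClosure_of_combo_mem {E : Type*} {G : Set (E → ℝ)}
    (hG : ∀ g₁ ∈ G, ∀ g₂ ∈ G, ∀ a b : ℝ, 0 ≤ a → 0 ≤ b → a + b = 1 →
      a • g₁ + b • g₂ ∈ lowerClosure G) :
    Convex ℝ (lowerClosure G : Set (E → ℝ)) := by
  rintro f₁ ⟨g₁, hg₁, hf₁⟩ f₂ ⟨g₂, hg₂, hf₂⟩ a b ha hb hab
  exact (lowerClosure G).lower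
    (add_le_add (smul_le_smul_of_nonneg_left hf₁ ha) (smul_le_smul_of_nonneg_left hf₂ hb))
    (hG g₁ hg₁ g₂ hg₂ a b ha hb hab)

theorem convex_lowerClosure_gains (s₀ : Fin J → ℝ) (H : I → Ω → ℝ) (hh : ConvexOn ℝ Θ h) :
    Convex ℝ (lowerClosure (gains s₀ H Θ h) : Set (Ω → ℝ)) := by
  refine convex_lowerClosure_of_combo_mem ?_
  rintro _ ⟨ϑ₁, hϑ₁, θ₁, hθ₁, rfl⟩ _ ⟨ϑ₂, hϑ₂, θ₂, hθ₂, rfl⟩ a b ha hb hab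
  refine mem_lowerClosure.2 ⟨_, ⟨a • ϑ₁ + b • ϑ₂, hϑ₁.combo hϑ₂ ha hb, a • θ₁ + b • θ₂,
    hh.1 hθ₁ hθ₂ ha hb hab, rfl⟩, fun ω => ?_⟩
  have hstatic := (concaveOn_staticGain (H := H) hh).2 hθ₁ hθ₂ ha hb hab ω
  simp only [dynGain_combo, Pi.add_apply, Pi.smul_apply, smul_eq_mul] at hstatic ⊢
  linarith

theorem staticGain_mem_gains (s₀ : Fin J → ℝ) (H : I → Ω → ℝ) (h : (I →₀ ℝ) → Ω → ℝ) {θ : I →₀ ℝ}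
    (hθ : θ ∈ Θ) : staticGain H h θ ∈ gains s₀ H Θ h :=
  ⟨_, isLongStrategy_zero s₀, θ, hθ, by simp [dynGain_zero]⟩

namespace IsDerivativeMarket

variable (D : IsDerivativeMarket Z H Θ h)
include D

theorem staticGain_zero : staticGain H h 0 = 0 := by
  rw [staticGain_eq, map_zero, D.cost_zero, sub_zero]

theorem zero_mem_gains : 0 ∈ gains s₀ H Θ h :=
  D.staticGain_zero ▸ staticGain_mem_gains s₀ H h D.zero_mem

theorem dynGain_mem_gains {ϑ : Fin T → Fin J → Ω → ℝ} (hϑ : IsLongStrategy s₀ ϑ) :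
    dynGain s₀ ϑ ∈ gains s₀ H Θ h :=
  ⟨ϑ, hϑ, 0, D.zero_mem, by simp [D.staticGain_zero]⟩

theorem continuous_staticGain {θ : I →₀ ℝ} (hθ : θ ∈ Θ) : Continuous (staticGain H h θ) :=
  (continuous_finsetSum _ fun i _ => continuous_const.mul (D.payoff_mem i).2).sub
    (D.cost_mem θ hθ).2

theorem staticGain_mem_dominatedBy (hZ : ∀ ω, 0 < Z ω) {θ : I →₀ ℝ} (hθ : θ ∈ Θ) :
    staticGain H h θ ∈ dominatedBy Z := by
  rw [staticGain_eq, Finsupp.linearCombination_apply]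
  exact sub_mem (Submodule.sum_mem _ fun i _ => Submodule.smul_mem _ _
    (mem_dominatedBy_of_mem_boundedBy hZ (D.payoff_mem i).1))
    (mem_dominatedBy_of_mem_boundedBy hZ (D.cost_mem θ hθ).1)

theorem integrable_staticGain (hZ : ∀ ω, 0 < Z ω) {P : ProbabilityMeasure Ω}
    (hP : Integrable Z (P : Measure Ω)) {θ : I →₀ ℝ} (hθ : θ ∈ Θ) :
    Integrable (staticGain H h θ) (P : Measure Ω) :=
  integrable_of_mem_dominatedBy hP (D.staticGain_mem_dominatedBy hZ hθ)
    (D.continuous_staticGain hθ).measurable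

theorem measurable_of_mem_gains {g : Ω → ℝ} (hg : g ∈ gains s₀ H Θ h) : Measurable g := by
  obtain ⟨ϑ, hϑ, θ, hθ, rfl⟩ := hg
  exact (measurable_dynGain hϑ).add (D.continuous_staticGain hθ).measurable

theorem penalty_eq_iSup (hZ : ∀ ω, 0 < Z ω) {P : ProbabilityMeasure Ω}
    (hP : Integrable Z (P : Measure Ω)) (hS : IsSupermartingaleMeasure s₀ P) :
    penalty (gains s₀ H Θ h) P = ⨆ θ ∈ Θ, expect P (staticGain H h θ) := by
  refine le_antisymm (iSup₂_le ?_)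
    (iSup₂_le fun θ hθ => expect_le_penalty P (staticGain_mem_gains s₀ H h hθ))
  rintro _ ⟨ϑ, hϑ, θ, hθ, rfl⟩
  exact (hS.expect_dynGain_add_le hϑ (D.integrable_staticGain hZ hP hθ)).trans
    (le_iSup₂ (f := fun θ (_ : θ ∈ Θ) => expect P (staticGain H h θ)) θ hθ)

end IsDerivativeMarket

end DerivativeMarket

section CallHedges

variable {J T : ℕ} {Ω : Set (Fin T → Fin (J + 1) → ℝ)} {s₀ : Fin J → ℝ} {p : ℝ}
  {G : Set (Ω → ℝ)}

/-- The payoff of a call with strike `K` on the `p`-th power of the `j`-th discounted price at time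
`k + 1`. -/
def powerCall (s₀ : Fin J → ℝ) (p K : ℝ) (k : Fin T) (j : Fin J) (ω : Ω) : ℝ :=
  max (discPrice s₀ k.succ j ω ^ p - K) 0

theorem powerCall_nonneg (s₀ : Fin J → ℝ) (p K : ℝ) (k : Fin T) (j : Fin J) (ω : Ω) :
    0 ≤ powerCall s₀ p K k j ω :=
  le_max_right _ _

theorem CallCondition.exists_strike (hcall : CallCondition s₀ p G) (c : ℝ) (k : Fin T)
    (j : Fin J) : ∃ K, c • powerCall s₀ p K k j - 1 ∈ lowerClosure G := by
  obtain ⟨n, hn⟩ := exists_nat_ge (max 1 c)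
  obtain ⟨hn1, hcn⟩ := max_le_iff.1 hn
  obtain ⟨X, hX, K, -, hle⟩ := hcall n (Nat.one_le_cast.1 hn1) j k
  refine ⟨K, mem_lowerClosure.2 ⟨X, hX, fun ω => le_trans ?_ (hle ω)⟩⟩
  change c * powerCall s₀ p K k j ω - 1 ≤ n * powerCall s₀ p K k j ω - 1 / n
  have hcost : 1 / (n : ℝ) ≤ 1 := div_le_one_of_le₀ hn1 n.cast_nonneg
  have hunits := mul_le_mul_of_nonneg_right hcn (powerCall_nonneg s₀ p K k j ω)
  linarith

theorem smul_sum_sub_one_mem {E ι : Type*} [Fintype ι] {A : LowerSet (E → ℝ)}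
    (hA : Convex ℝ (A : Set (E → ℝ))) (hA0 : 0 ∈ A) {f : ι → E → ℝ} {c : ℝ}
    (hf : ∀ i, (Fintype.card ι * c) • f i - 1 ∈ A) : c • ∑ i, f i - 1 ∈ A := by
  rcases isEmpty_or_nonempty ι with _ | _
  · exact A.lower (by simp) hA0
  have hcard : (Fintype.card ι : ℝ) ≠ 0 := Nat.cast_ne_zero.2 Fintype.card_ne_zero
  have haverage := hA.sum_mem (t := Finset.univ) (w := fun _ : ι => (Fintype.card ι : ℝ)⁻¹)
    (fun _ _ => by positivity) (by simp [hcard]) fun i _ => hf i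
  have hsum : ∑ i, (Fintype.card ι : ℝ)⁻¹ • ((Fintype.card ι * c) • f i - 1)
      = c • ∑ i, f i - 1 := by
    simp only [smul_sub, smul_smul, inv_mul_cancel_left₀ hcard, Finset.sum_sub_distrib,
      Finset.smul_sum, Finset.sum_const, Finset.card_univ, ← Nat.cast_smul_eq_nsmul ℝ,
      mul_inv_cancel₀ hcard, one_smul]
  exact hsum ▸ haverage

theorem growth_le_two_mul_sum_powerCall {K : Fin T × Fin J → ℝ} {ω : Ω}
    (hω : 2 * (1 + ∑ i, K i) < growth s₀ p ω) :
    growth s₀ p ω ≤ 2 * ∑ i : Fin T × Fin J, powerCall s₀ p (K i) i.1 i.2 ω := by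
  have hgrowth : growth s₀ p ω = 1 + ∑ i : Fin T × Fin J, discPrice s₀ i.1.succ i.2 ω ^ p := by
    rw [growth, Fintype.sum_prod_type]
  have hcalls : ∑ i : Fin T × Fin J, (discPrice s₀ i.1.succ i.2 ω ^ p - K i)
      ≤ ∑ i : Fin T × Fin J, powerCall s₀ p (K i) i.1 i.2 ω :=
    Finset.sum_le_sum fun _ _ => le_max_left _ _
  rw [Finset.sum_sub_distrib] at hcalls
  linarith

theorem smul_tailPart_growth_le (hZ : 0 ≤ (growth s₀ p : Ω → ℝ)) (c : ℝ) (K : Fin T × Fin J → ℝ) :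
    c • (tailPart (growth s₀ p : Ω → ℝ) (2 * (1 + ∑ i, K i))).1
      ≤ (2 * |c|) • ∑ i : Fin T × Fin J, powerCall s₀ p (K i) i.1 i.2 := by
  intro ω
  simp only [tailPart, Pi.smul_apply, Finset.sum_apply, smul_eq_mul]
  by_cases hω : 2 * (1 + ∑ i, K i) < growth s₀ p ω
  · rw [indicator_of_mem (show ω ∈ {ω | _ < growth s₀ p ω} from hω)]
    calc c * growth s₀ p ω ≤ |c| * growth s₀ p ω :=
          mul_le_mul_of_nonneg_right (le_abs_self c) (hZ ω)
      _ ≤ |c| * (2 * ∑ i : Fin T × Fin J, powerCall s₀ p (K i) i.1 i.2 ω) := by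
          gcongr
          exact growth_le_two_mul_sum_powerCall hω
      _ = 2 * |c| * ∑ i : Fin T × Fin J, powerCall s₀ p (K i) i.1 i.2 ω := by ring
  · rw [indicator_of_notMem (show ω ∉ {ω | _ < growth s₀ p ω} from hω), mul_zero]
    exact mul_nonneg (by positivity) (Finset.sum_nonneg fun _ _ => powerCall_nonneg ..)

theorem CallCondition.exists_hedge_tailPart (hcall : CallCondition s₀ p G)
    (hG : Convex ℝ (lowerClosure G : Set (Ω → ℝ))) (hG0 : 0 ∈ G)
    (hZ : 0 ≤ (growth s₀ p : Ω → ℝ)) (c : ℝ) :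
    ∃ R, 1 ∈ hedgeCapital G (c • (tailPart (growth s₀ p : Ω → ℝ) R).1) := by
  choose K hhedge using fun i : Fin T × Fin J =>
    hcall.exists_strike (Fintype.card (Fin T × Fin J) * (2 * |c|)) i.1 i.2
  refine ⟨2 * (1 + ∑ i, K i), (lowerClosure G).lower ?_
    (smul_sum_sub_one_mem hG (subset_lowerClosure hG0) hhedge)⟩
  rw [one_smul]
  exact sub_le_sub_right (smul_tailPart_growth_le hZ c K) 1

end CallHedges

section Market

variable {J T : ℕ} {Ω : Set (Fin T → Fin (J + 1) → ℝ)} {I : Type*} {a b : Fin T → ℝ}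
  {s₀ : Fin J → ℝ} {p : ℝ} {H : I → Ω → ℝ} {Θ : Set (I →₀ ℝ)} {h : (I →₀ ℝ) → Ω → ℝ}
  (M : IsPriceModel Ω a b s₀) (D : IsDerivativeMarket (growth s₀ p) H Θ h)
include M D

theorem penalty_le_of_forall_continuous (hp : 1 ≤ p) {P : ProbabilityMeasure Ω}
    (hP : Integrable (growth s₀ p) (P : Measure Ω)) {c : ℝ}
    (hc : ∀ g ∈ gains s₀ H Θ h, Continuous g → g ∈ dominatedBy (growth s₀ p) →
      ∫ ω, g ω ∂(P : Measure Ω) ≤ c) :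
    penalty (gains s₀ H Θ h) P ≤ (c : EReal) := by
  have hS : IsSupermartingaleMeasure s₀ P :=
    M.isSupermartingaleMeasure hp (fun ϑ hϑ => hc _ (D.dynGain_mem_gains hϑ)) hP
  rw [D.penalty_eq_iSup (M.growth_pos p) hP hS]
  refine iSup₂_le fun θ hθ => ?_
  rw [expect_of_integrable P (D.integrable_staticGain (M.growth_pos p) hP hθ)]
  exact EReal.coe_le_coe_iff.2 (hc _ (staticGain_mem_gains s₀ H h hθ)
    (D.continuous_staticGain hθ) (D.staticGain_mem_dominatedBy (M.growth_pos p) hθ))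

theorem penalty_eq_top (hp : 1 ≤ p) {P : ProbabilityMeasure Ω}
    (hP : Integrable (growth s₀ p) (P : Measure Ω)) (hS : ¬ IsSupermartingaleMeasure s₀ P) :
    penalty (gains s₀ H Θ h) P = ⊤ := by
  by_contra htop
  refine hS (M.isSupermartingaleMeasure hp (C := (penalty (gains s₀ H Θ h) P).toReal)
    (fun ϑ hϑ hcont hdom => ?_) hP)
  have hle := expect_le_penalty P (D.dynGain_mem_gains hϑ)
  rw [expect_of_integrable P (integrable_of_mem_dominatedBy hP hdom hcont.measurable)] at hle
  exact EReal.coe_le_coe_iff.1 (hle.trans (EReal.le_coe_toReal htop))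

theorem isHedgingSet_gains (hcall : CallCondition s₀ p (gains s₀ H Θ h))
    (hNA : ¬ ∃ X ∈ gains s₀ H Θ h, ∃ ε : ℝ, 0 < ε ∧ ∀ ω, ε ≤ X ω) :
    IsHedgingSet (growth s₀ p) (gains s₀ H Θ h) where
  one_le := M.one_le_growth p
  zero_mem := D.zero_mem_gains
  convex := convex_lowerClosure_gains s₀ H D.cost_convex
  noArbitrage := fun ε hε ⟨X, hX, hle⟩ => hNA ⟨X, hX, ε, hε, fun ω => by simpa using hle ω⟩
  tail := hcall.exists_hedge_tailPart (convex_lowerClosure_gains s₀ H D.cost_convex)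
    D.zero_mem_gains (zero_le_one.trans (M.one_le_growth p))

theorem isGreatest_superhedge (hp : 1 ≤ p) (hG : IsHedgingSet (growth s₀ p) (gains s₀ H Θ h))
    {X : Ω → ℝ} (hX : X ∈ uscBoundedBy (growth s₀ p)) :
    IsGreatest ((fun P => expect P X - penalty (gains s₀ H Θ h) P) '' probInt (growth s₀ p))
      (superhedge (posCone Ω) (gains s₀ H Θ h) X) := by
  have hm : ∀ g ∈ gains s₀ H Θ h, Measurable g := fun g => D.measurable_of_mem_gains
  have hXZ := mem_dominatedBy_of_mem_boundedBy (M.growth_pos p) hX.1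
  have hint : ∀ P ∈ probInt (growth s₀ p), Integrable X (P : Measure Ω) := fun P hP =>
    integrable_of_mem_dominatedBy hP hXZ hX.1.1
  have hweak : ∀ P ∈ probInt (growth s₀ p), expect P X - penalty (gains s₀ H Θ h) P
      ≤ superhedge (posCone Ω) (gains s₀ H Θ h) X := fun P hP =>
    expect_sub_penalty_le_superhedge hm hX.1.1 (hint P hP)
  have := M.locallyCompactSpace
  obtain ⟨P, hP, hdual⟩ := hG.exists_dual (M.continuous_growth (zero_le_one.trans hp))
    (M.isCompact_growth_le hp) hXZ hX.2
  have hpen := penalty_le_of_forall_continuous M D hp hP hdual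
  refine ⟨⟨P, hP, le_antisymm (hweak P hP) ?_⟩, forall_mem_image.2 hweak⟩
  calc superhedge (posCone Ω) (gains s₀ H Θ h) X
      = ((∫ ω, X ω ∂(P : Measure Ω) : ℝ) : EReal)
        - (∫ ω, X ω ∂(P : Measure Ω) - hedgeCost (gains s₀ H Θ h) X : ℝ) := by
        rw [hG.superhedge_eq hm hX.1.1 hXZ, ← EReal.coe_sub, sub_sub_cancel]
    _ ≤ expect P X - penalty (gains s₀ H Θ h) P :=
        EReal.sub_le_sub (expect_of_integrable P (hint P hP)).ge hpen

end Market

end ShortSelling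

end

open ShortSelling in
theorem proposition3p2 {J T : ℕ} (Ω : Set (Fin T → Fin (J + 1) → ℝ))
    (hne : Ω.Nonempty) (hclosed : IsClosed Ω)
    (a b : Fin T → ℝ) (ha : ∀ k, 0 < a k) (hab : ∀ k, a k ≤ b k)
    (hΩ : ∀ ω ∈ Ω, ∀ k, ω k 0 ∈ Set.Icc (a k) (b k) ∧ ∀ j : Fin J, 0 ≤ ω k j.succ)
    (s₀ : Fin J → ℝ) (hs₀ : ∀ j, 0 ≤ s₀ j)
    (p : ℝ) (hp : 1 ≤ p) (Z : Ω → ℝ) (hZ : Z = growth s₀ p)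
    {I : Type*} (H : I → Ω → ℝ) (hH : ∀ i, H i ∈ contBoundedBy Z)
    (Θ : Set (I →₀ ℝ)) (hΘ : Convex ℝ Θ) (hΘ0 : 0 ∈ Θ)
    (h : (I →₀ ℝ) → Ω → ℝ) (hhC : ∀ θ ∈ Θ, h θ ∈ contBoundedBy Z)
    (hhconv : ConvexOn ℝ Θ h) (hh0 : h 0 = 0)
    (G : Set (Ω → ℝ)) (hG : G = gains s₀ H Θ h) :
    (∀ P ∈ probInt Z,
      (IsSupermartingaleMeasure s₀ P → penalty G P = ⨆ θ ∈ Θ, expect P (staticGain H h θ)) ∧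
      (¬ IsSupermartingaleMeasure s₀ P → penalty G P = ⊤)) ∧
    (CallCondition s₀ p G →
      List.TFAE [
        ¬ ∃ X ∈ G, ∃ ε : ℝ, 0 < ε ∧ ∀ ω, ε ≤ X ω,
        ¬ ∃ X ∈ G, ∀ ω, 0 < X ω,
        (genMartMeasures Z G).Nonempty,
        (∀ X ∈ boundedBy Z, ∃ r : ℝ, superhedge (posCone Ω) G X = (r : EReal)) ∧
          superhedge (posCone Ω) G 0 = 0 ∧
          ∀ X ∈ uscBoundedBy Z,
            IsGreatest ((fun P => expect P X - penalty G P) '' probInt Z)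
              (superhedge (posCone Ω) G X)]) := by
  subst hZ hG
  have M : IsPriceModel Ω a b s₀ := ⟨hclosed, ha, hΩ, hs₀⟩
  have D : IsDerivativeMarket (growth s₀ p) H Θ h := ⟨hH, hΘ0, hhC, hhconv, hh0⟩
  have hm : ∀ g ∈ gains s₀ H Θ h, Measurable g := fun g => D.measurable_of_mem_gains
  refine ⟨fun P hP => ⟨D.penalty_eq_iSup (M.growth_pos p) hP, penalty_eq_top M D hp hP⟩,
    fun hcall => ?_⟩
  tfae_have 1 → 4 := fun hNA => by
    have hG := isHedgingSet_gains M D hcall hNA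
    exact ⟨fun X hX => ⟨_, hG.superhedge_eq hm hX.1
        (mem_dominatedBy_of_mem_boundedBy (M.growth_pos p) hX)⟩,
      hG.superhedge_zero hm, fun X hX => isGreatest_superhedge M D hp hG hX⟩
  tfae_have 4 → 3 := fun ⟨_, h0, hmax⟩ =>
    genMartMeasures_nonempty_of_isGreatest (h0 ▸ hmax 0 (zero_mem_uscBoundedBy _))
  tfae_have 3 → 2 := fun ⟨_, hP⟩ => not_exists_pos_of_mem_genMartMeasures hm hP
  tfae_have 2 → 1 := fun h2 ⟨X, hX, ε, hε, hle⟩ => h2 ⟨X, hX, fun ω => hε.trans_le (hle ω)⟩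
  tfae_finish
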